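/- Conventions. A quasimetric space is a set $X$ with a map $d\colon X\times X\to[0,\infty]$ satisfying the triangle inequality and $d(x,y)=0\iff x=y$; short maps are the maps that do not increase $d$, and $d(\varphi,\psi)=\sup_x d(\varphi(x),\psi(x))$ for short maps $\varphi,\psi\colon X\to Y$. For a real $r\ge 0$, $\varphi\sim_r\psi$ means that there are short maps $\varphi=\varphi_0,\dots,\varphi_m=\psi$ with $d(\varphi_i,\varphi_{i+1})\le r$ or $d(\varphi_{i+1},\varphi_i)\le r$ for every $i$; $r$-homotopy equivalence is isomorphism in the category of quasimetric spaces and short maps modulo $\sim_r$. A subset $A\subseteq X$ with inclusion $\iota$ is an $r$-deformation retract if there is a short map $\rho\colon X\to A$ with $\rho\iota=1_A$ and $\iota\rho\sim_r 1_X$. A finite quasimetric space is $r$-minimal if it has no proper $r$-deformation retract; the $r$-minimal model $M_r(X)$ of a finite $X$ is the $r$-minimal space, unique up to isometry, that is $r$-homotopy equivalent to $X$ (it can be realised as an $r$-deformation retract of $X$). The homotopy jumping points of $X$ are the reals $r>0$ such that $|M_r(X)|/|X|<|M_s(X)|/|X|$ for all $0\le s<r$, and $M_{\rm stab}(X)=M_{r}(X)$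 for the largest jumping point $r$, or $M_{\rm stab}(X)=X$ if there is none. A digraph is identified with its vertex set equipped with the shortest directed path distance (a quasimetric, with value $\infty$ if there is no path); the minimal models of a finite digraph are again digraphs (full subdigraphs of it). Let $\mathbb K$ be a commutative ring. For a digraph $G$ let ${\rm RC}_n(G)$ be the free $\mathbb K$-module on the tuples $(g_0,\dots,g_n)$ of vertices with $g_i\ne g_{i+1}$ and $d(g_i,g_{i+1})<\infty$, with differential $\partial(g_0,\dots,g_n)=\sum_i(-1)^i(g_0,\dots,\widehat{g_i},\dots,g_n)$ (for $n\ge 1$; $\partial=0$ on ${\rm RC}_0(G)$), where tuples with a consecutive repetition are read as $0$, filtered by letting $F_\ell{\rm RC}_n(G)$ be spanned by the tuples with $\sum_i d(g_i,g_{i+1})\le\ell$. The magnitude-path spectral sequence $E(G)$ is the spectral sequence of this filtered complex, with pages $E^r(G)$, $r\ge1$; its first page is $E^1_{\ell,n-\ell}(G)=H_n(F_\ell/F_{\ell-1})$. **Theorem.** Let $G$ be a finite digraph. Its set of homotopy jumping points is a finite set $\{r_1<\dots<r_n\}$ of positive integers (possibly empty), and there are spectral sequences of $\mathbb K$-modules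 $E(G)_{[1]},\dots,E(G)_{[n]}$ and $E(G)_{[\infty]}$ with an isomorphism of spectral sequences $$E(G)\;\cong\;\bigoplus_{k=1}^n E(G)_{[k]}\;\oplus\;E(G)_{[\infty]}$$ such that $E^{\,r_k+1}(G)_{[k]}=0$ for every $1\le k\le n$, and for every $1\le j\le n$ $$E(M_{r_j}(G))\;\cong\;\bigoplus_{k=j+1}^n E(G)_{[k]}\;\oplus\;E(G)_{[\infty]}.$$ In particular, $E(M_{\rm stab}(G))\cong E(G)_{[\infty]}$. -/

import Mathlib

open CategoryTheory
open scoped NNReal ENNReal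

universe u v w

/-! ### Quasimetric spaces and `r`-homotopy -/

/-- A quasimetric on `X`: a map `d : X × X → [0, ∞]` which satisfies the triangle inequality and
vanishes exactly on the diagonal. It need not be symmetric, and it may take the value `∞`. -/
structure Quasimetric (X : Type*) where
  d : X → X → ℝ≥0∞
  d_eq_zero_iff : ∀ x y, d x y = 0 ↔ x = y
  triangle : ∀ x y z, d x z ≤ d x y + d y z

namespace Quasimetric

variable {X Y Z : Type*}

/-- The induced quasimetric on a subset. -/
def restrict (D : Quasimetric X) (A : Set X) : Quasimetric A where
  d x y := D.d x y
  d_eq_zero_iff _ _ := (D.d_eq_zero_iff _ _).trans Subtype.coe_inj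
  triangle _ _ _ := D.triangle _ _ _

/-- Short (distance non-increasing) maps between quasimetric spaces. -/
def ShortMap (D : Quasimetric X) (E : Quasimetric Y) : Type _ :=
  {f : X → Y // ∀ x x', E.d (f x) (f x') ≤ D.d x x'}

/-- The identity short map. -/
def idMap (D : Quasimetric X) : ShortMap D D := ⟨id, fun _ _ => le_rfl⟩

/-- The composition of short maps, `g` after `f`. -/
def ShortMap.comp {D : Quasimetric X} {E : Quasimetric Y} {F : Quasimetric Z}
    (g : ShortMap E F) (f : ShortMap D E) : ShortMap D F :=
  ⟨g.1 ∘ f.1, fun x x' => (g.2 _ _).trans (f.2 x x')⟩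

/-- The inclusion of a subset, with the induced quasimetric. -/
def incl (D : Quasimetric X) (A : Set X) : ShortMap (D.restrict A) D :=
  ⟨Subtype.val, fun _ _ => le_rfl⟩

/-- The quasimetric `d(φ, ψ) = sup_x d(φ(x), ψ(x))` on the set of short maps. -/
noncomputable def onShortMaps (D : Quasimetric X) (E : Quasimetric Y) :
    Quasimetric (ShortMap D E) where
  d φ ψ := ⨆ x, E.d (φ.1 x) (ψ.1 x)
  d_eq_zero_iff φ ψ := by
    simp only [ENNReal.iSup_eq_zero, E.d_eq_zero_iff]
    exact ⟨fun h => Subtype.ext (funext h), fun h => by simp [h]⟩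
  triangle φ ψ χ := iSup_le fun x => (E.triangle _ (ψ.1 x) _).trans
    (add_le_add (le_iSup (fun x => E.d (φ.1 x) (ψ.1 x)) x)
      (le_iSup (fun x => E.d (ψ.1 x) (χ.1 x)) x))

/-- Two points are `r`-homotopic if they are joined by a finite sequence of points such that any
two successive ones are at distance at most `r` in at least one of the two directions. -/
def HomotopicPoints (D : Quasimetric X) (r : ℝ≥0) : X → X → Prop :=
  Relation.ReflTransGen fun x y => D.d x y ≤ r ∨ D.d y x ≤ r

/-- Two short maps are `r`-homotopic if they are so as points of the space of short maps. -/
def Homotopic {D : Quasimetric X} {E : Quasimetric Y} (r : ℝ≥0) (φ ψ : ShortMap D E) : Prop :=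
  (onShortMaps D E).HomotopicPoints r φ ψ

/-- `X` and `Y` are `r`-homotopy equivalent: they are isomorphic in the category of quasimetric
spaces and `r`-homotopy classes of short maps. -/
def HomotopyEquivalent (r : ℝ≥0) (D : Quasimetric X) (E : Quasimetric Y) : Prop :=
  ∃ (φ : ShortMap D E) (ψ : ShortMap E D),
    Homotopic r (ψ.comp φ) D.idMap ∧ Homotopic r (φ.comp ψ) E.idMap

/-- `A ⊆ X` is an `r`-deformation retract: there is a short retraction `ρ : X → A` onto `A`
such that the composite `X → A → X` is `r`-homotopic to the identity. -/
def IsDeformationRetract (r : ℝ≥0) (D : Quasimetric X) (A : Set X) : Prop :=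
  ∃ ρ : ShortMap D (D.restrict A),
    ρ.comp (D.incl A) = (D.restrict A).idMap ∧ Homotopic r ((D.incl A).comp ρ) D.idMap

/-- A finite quasimetric space is `r`-minimal if it has no proper `r`-deformation retract. -/
def IsMinimal (r : ℝ≥0) (D : Quasimetric X) : Prop :=
  Finite X ∧ ∀ A : Set X, IsDeformationRetract r D A → A = Set.univ

/-- `(Y, E)` is an `r`-minimal model of `(X, D)`. -/
def IsMinimalModel (r : ℝ≥0) (E : Quasimetric Y) (D : Quasimetric X) : Prop :=
  IsMinimal r E ∧ HomotopyEquivalent r D E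

theorem HomotopicPoints.map {D : Quasimetric X} {E : Quasimetric Y} {r : ℝ≥0} (f : X → Y)
    (hf : ∀ x x', E.d (f x) (f x') ≤ D.d x x') {x y : X} (h : D.HomotopicPoints r x y) :
    E.HomotopicPoints r (f x) (f y) := by
  induction h with
  | refl => exact Relation.ReflTransGen.refl
  | tail _ h ih =>
    exact Relation.ReflTransGen.tail ih
      (h.imp (fun h => (hf _ _).trans h) (fun h => (hf _ _).trans h))

theorem Homotopic.comp_left {D : Quasimetric X} {E : Quasimetric Y} {F : Quasimetric Z} {r : ℝ≥0}
    (β : ShortMap E F) {φ ψ : ShortMap D E} (h : Homotopic r φ ψ) :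
    Homotopic r (β.comp φ) (β.comp ψ) :=
  HomotopicPoints.map (fun f : ShortMap D E => β.comp f)
    (fun _ _ => iSup_mono fun _ => β.2 _ _) h

theorem Homotopic.comp_right {D : Quasimetric X} {E : Quasimetric Y} {F : Quasimetric Z} {r : ℝ≥0}
    (α : ShortMap D E) {φ ψ : ShortMap E F} (h : Homotopic r φ ψ) :
    Homotopic r (φ.comp α) (ψ.comp α) :=
  HomotopicPoints.map (fun f : ShortMap E F => f.comp α)
    (fun f g => iSup_le fun x => le_iSup (fun y => F.d (f.1 y) (g.1 y)) (α.1 x)) h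

theorem IsDeformationRetract.homotopyEquivalent {r : ℝ≥0} {D : Quasimetric X} {A : Set X}
    (h : IsDeformationRetract r D A) : HomotopyEquivalent r D (D.restrict A) := by
  obtain ⟨ρ, h1, h2⟩ := h
  exact ⟨ρ, D.incl A, h2, by rw [h1]; exact Relation.ReflTransGen.refl⟩

/-- An `r`-deformation retract of least cardinality is `r`-minimal. -/
theorem exists_minimal_deformationRetract [Finite X] (r : ℝ≥0) (D : Quasimetric X) :
    ∃ A : Set X, IsDeformationRetract r D A ∧ IsMinimal r (D.restrict A) := by
  classical
  have hne : {A : Set X | IsDeformationRetract r D A}.Nonempty :=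
    ⟨Set.univ, ⟨fun x => ⟨x, trivial⟩, fun _ _ => le_rfl⟩, rfl, Relation.ReflTransGen.refl⟩
  obtain ⟨A, hA, hmin⟩ := (Set.toFinite {A : Set X | IsDeformationRetract r D A}).exists_minimal hne
  refine ⟨A, hA, inferInstance, fun B hB => ?_⟩
  obtain ⟨ρ, h1, h2⟩ := hA
  obtain ⟨σ, h3, h4⟩ := hB
  have key : IsDeformationRetract r D (Subtype.val '' B) := by
    refine ⟨⟨fun x => ⟨(σ.1 (ρ.1 x)).1.1, _, (σ.1 (ρ.1 x)).2, rfl⟩, fun x x' =>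
      (σ.2 _ _).trans (ρ.2 x x')⟩, ?_, ?_⟩
    · apply Subtype.ext
      funext x
      obtain ⟨x, b, hb, rfl⟩ := x
      have e1 : ρ.1 b.1 = b := congrFun (congrArg Subtype.val h1) b
      have e2 : σ.1 b = ⟨b, hb⟩ := congrFun (congrArg Subtype.val h3) ⟨b, hb⟩
      apply Subtype.ext
      change (σ.1 (ρ.1 b.1)).1.1 = b.1
      rw [e1, e2]
    · exact Relation.ReflTransGen.trans
        ((h4.comp_right ρ).comp_left (D.incl A)) h2
  have hle := hmin key (Subtype.coe_image_subset A B)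
  ext ⟨x, hx⟩
  simp only [Set.mem_univ, iff_true]
  obtain ⟨b, hb, hbx⟩ := hle hx
  exact (Subtype.ext hbx : b = ⟨x, hx⟩) ▸ hb

/-- The `r`-minimal model `M_r(X)` of a finite quasimetric space `X`, realised as an
`r`-deformation retract of `X` (chosen; it is well defined up to isometry). -/
noncomputable def minimalModel [Finite X] (r : ℝ≥0) (D : Quasimetric X) : Set X :=
  (exists_minimal_deformationRetract r D).choose

theorem minimalModel_isDeformationRetract [Finite X] (r : ℝ≥0) (D : Quasimetric X) :
    IsDeformationRetract r D (minimalModel r D) :=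
  (exists_minimal_deformationRetract r D).choose_spec.1

theorem minimalModel_isMinimalModel [Finite X] (r : ℝ≥0) (D : Quasimetric X) :
    IsMinimalModel r (D.restrict (minimalModel r D)) D :=
  ⟨(exists_minimal_deformationRetract r D).choose_spec.2,
    (exists_minimal_deformationRetract r D).choose_spec.1.homotopyEquivalent⟩

/-- The function `c_X(r) = |M_r(X)| / |X|`. -/
noncomputable def cardRatio [Finite X] (D : Quasimetric X) (r : ℝ≥0) : ℝ :=
  (Nat.card (minimalModel r D) : ℝ) / Nat.card X

/-- The set `hj(X)` of homotopy jumping points: the positive reals `r` such that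
`c_X(r) < c_X(s)` for all `s` with `0 ≤ s < r`. -/
def jumpingPoints [Finite X] (D : Quasimetric X) : Set ℝ≥0 :=
  {r | 0 < r ∧ ∀ s < r, cardRatio D r < cardRatio D s}

open Classical in
/-- The stable model `M_stab(X)`: it is `M_r(X)` for `r` the largest homotopy jumping point of
`X`, and `X` itself if there is no homotopy jumping point. -/
noncomputable def stableModel [Finite X] (D : Quasimetric X) : Set X :=
  if (jumpingPoints D).Nonempty then minimalModel (sSup (jumpingPoints D)) D else Set.univ

end Quasimetric

/-! ### Digraphs as quasimetric spaces -/

namespace Digraph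

variable {V : Type*}

/-- The length of a shortest directed path from `v` to `w`, and `∞` if there is no such path.
The constant path has length `0`, so degenerate arrows (loops) do not matter. -/
noncomputable def pathDist (G : Digraph V) (v w : V) : ℕ∞ :=
  ⨅ (n : ℕ) (_ : ∃ p : ℕ → V, p 0 = v ∧ p n = w ∧ ∀ i < n, G.Adj (p i) (p (i + 1))), (n : ℕ∞)

theorem pathDist_le {G : Digraph V} {v w : V} {n : ℕ} (p : ℕ → V) (h0 : p 0 = v) (hn : p n = w)
    (h : ∀ i < n, G.Adj (p i) (p (i + 1))) : G.pathDist v w ≤ n :=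
  iInf₂_le n ⟨p, h0, hn, h⟩

theorem exists_path {G : Digraph V} {v w : V} (h : G.pathDist v w < ⊤) :
    ∃ (n : ℕ) (p : ℕ → V), G.pathDist v w = n ∧ p 0 = v ∧ p n = w ∧
      ∀ i < n, G.Adj (p i) (p (i + 1)) := by
  have hex : ∃ n : ℕ, ∃ p : ℕ → V, p 0 = v ∧ p n = w ∧ ∀ i < n, G.Adj (p i) (p (i + 1)) := by
    by_contra hcon
    push Not at hcon
    refine h.ne (iInf₂_eq_top.2 ?_)
    rintro n ⟨p, h0, hn, hp⟩
    obtain ⟨i, hi, hi'⟩ := hcon n p h0 hn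
    exact absurd (hp i hi) hi'
  classical
  obtain ⟨p, h0, hn, hp⟩ := Nat.find_spec hex
  exact ⟨Nat.find hex, p, le_antisymm (pathDist_le p h0 hn hp)
    (le_iInf₂ fun m hm => by exact_mod_cast Nat.find_min' hex hm), h0, hn, hp⟩

theorem pathDist_eq_zero_iff (G : Digraph V) (v w : V) : G.pathDist v w = 0 ↔ v = w := by
  constructor
  · intro h
    obtain ⟨n, p, h1, h0, hn, -⟩ := exists_path (G := G) (v := v) (w := w) (by simp [h])
    have : n = 0 := by rw [h] at h1; exact_mod_cast h1.symm
    subst this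
    exact h0.symm.trans hn
  · rintro rfl
    exact le_antisymm (pathDist_le (n := 0) (fun _ => v) rfl rfl (by simp)) bot_le

theorem pathDist_triangle (G : Digraph V) (u v w : V) :
    G.pathDist u w ≤ G.pathDist u v + G.pathDist v w := by
  by_cases h1 : G.pathDist u v < ⊤
  · by_cases h2 : G.pathDist v w < ⊤
    · obtain ⟨m, p, hm, p0, pm, hp⟩ := exists_path h1
      obtain ⟨n, q, hn, q0, qn, hq⟩ := exists_path h2
      rw [hm, hn, ← Nat.cast_add]
      refine pathDist_le (fun i => if i ≤ m then p i else q (i - m)) (by simpa using p0) ?_ ?_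
      · by_cases h : n = 0
        · subst h; simp [pm, ← q0, qn]
        · simp [h, qn]
      · intro i hi
        rcases lt_trichotomy i m with h | rfl | h
        · simpa [h.le, Nat.succ_le_of_lt h] using hp i h
        · have := hq 0 (by omega)
          simpa [pm, ← q0] using this
        · have := hq (i - m) (by omega)
          rw [show i - m + 1 = i + 1 - m by omega] at this
          simpa [not_le.2 h, show ¬ i + 1 ≤ m by omega] using this
    · simp [not_lt_top_iff.1 h2]
  · simp [not_lt_top_iff.1 h1]

/-- The quasimetric space `Q(G)` of a digraph: its vertices with the shortest path distance. -/
noncomputable def toQuasimetric (G : Digraph V) : Quasimetric V where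
  d v w := (G.pathDist v w : ℝ≥0∞)
  d_eq_zero_iff v w := by simp [pathDist_eq_zero_iff]
  triangle u v w := by
    rw [← ENat.toENNReal_add]
    exact ENat.toENNReal_le.2 (G.pathDist_triangle u v w)

/-- The full subdigraph on a set of vertices. -/
def inducedOn (G : Digraph V) (A : Set V) : Digraph A where
  Adj v w := G.Adj v w

theorem pathDist_le_pathDist_inducedOn (G : Digraph V) (A : Set V) (v w : A) :
    G.pathDist v w ≤ (G.inducedOn A).pathDist v w :=
  le_iInf₂ fun _ ⟨p, h0, hn, hp⟩ =>
    pathDist_le (fun i => (p i : V)) (by rw [h0]) (by rw [hn]) hp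

/-- A retract of `Q(G)` is the quasimetric space of the full subdigraph of `G` on it. -/
theorem toQuasimetric_inducedOn (G : Digraph V) {A : Set V} {r : ℝ≥0}
    (hA : G.toQuasimetric.IsDeformationRetract r A) :
    (G.inducedOn A).toQuasimetric = G.toQuasimetric.restrict A := by
  obtain ⟨ρ, hρ, -⟩ := hA
  have hfix : ∀ a : A, ρ.1 a = a := fun a => congrFun (congrArg Subtype.val hρ) a
  have hstep : ∀ v w, G.Adj v w → (G.inducedOn A).pathDist (ρ.1 v) (ρ.1 w) ≤ 1 := by
    intro v w hvw
    have h1 : G.pathDist v w ≤ (1 : ℕ) :=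
      pathDist_le (fun i => if i = 0 then v else w) rfl rfl (by simpa using hvw)
    have h2 : G.pathDist (ρ.1 v) (ρ.1 w) ≤ (1 : ℕ) :=
      (ENat.toENNReal_le.1 (ρ.2 v w)).trans h1
    obtain ⟨n, p, hn, h0, hpn, hp⟩ := exists_path (h2.trans_lt (ENat.natCast_lt_top 1))
    rw [hn] at h2
    have hn1 : n ≤ 1 := by exact_mod_cast h2
    interval_cases n
    · have : ρ.1 v = ρ.1 w := Subtype.ext (h0.symm.trans hpn)
      rw [this, ((G.inducedOn A).pathDist_eq_zero_iff _ _).2 rfl]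
      exact zero_le
    · have hadj := hp 0 one_pos
      rw [h0, zero_add, hpn] at hadj
      exact pathDist_le (n := 1) (fun i => if i = 0 then ρ.1 v else ρ.1 w) rfl rfl
        (by simpa [inducedOn] using hadj)
  have hle : ∀ a b : A, (G.inducedOn A).pathDist a b ≤ G.pathDist a b := by
    intro a b
    refine le_iInf₂ fun n ⟨p, h0, hn, hp⟩ => ?_
    have key : ∀ m ≤ n, (G.inducedOn A).pathDist (ρ.1 (p 0)) (ρ.1 (p m)) ≤ m := by
      intro m
      induction m with
      | zero => intro _; rw [((G.inducedOn A).pathDist_eq_zero_iff _ _).2 rfl]; exact zero_le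
      | succ m ih =>
        intro hm
        refine (pathDist_triangle _ _ (ρ.1 (p m)) _).trans ?_
        push_cast
        exact add_le_add (ih (by omega)) (hstep _ _ (hp m (by omega)))
    have := key n le_rfl
    rwa [h0, hn, hfix, hfix] at this
  have hd : (G.inducedOn A).toQuasimetric.d = (G.toQuasimetric.restrict A).d := by
    funext a b
    exact congrArg ENat.toENNReal (le_antisymm (hle a b) (G.pathDist_le_pathDist_inducedOn A a b))
  revert hd
  generalize (G.inducedOn A).toQuasimetric = D, G.toQuasimetric.restrict A = E
  cases D; cases E
  rintro rfl
  rfl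

end Digraph

/-! ### The spectral sequence of a filtered complex -/

/-- Homological spectral sequences of `K`-modules starting with the first page: the differential
of the `r`-th page maps `E^r_{p,q}` to `E^r_{p-r,q+r-1}`. -/
abbrev HomologicalSpectralSequence (K : Type v) [CommRing K] :=
  SpectralSequence (ModuleCat.{w} K) (fun r => ComplexShape.up' ((-r, r - 1) : ℤ × ℤ)) 1

/-- A `ℤ`-filtered chain complex of `K`-modules, with an increasing filtration. -/
structure FilteredComplex (K : Type v) [CommRing K] where
  /-- the underlying chain complex -/
  C : HomologicalComplex (ModuleCat.{w} K) (ComplexShape.down ℤ)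
  /-- the degree `n` part of the `p`-th term of the filtration -/
  F (p n : ℤ) : Submodule K (C.X n)
  mono {p p' : ℤ} (h : p ≤ p') (n : ℤ) : F p n ≤ F p' n
  d_mem {p n : ℤ} (m : ℤ) {x : C.X n} (hx : x ∈ F p n) : (C.d n m).hom x ∈ F p m

namespace FilteredComplex

variable {K : Type v} [CommRing K] (A : FilteredComplex.{v, w} K)

theorem d_d (i j k : ℤ) (x : A.C.X i) : (A.C.d j k).hom ((A.C.d i j).hom x) = 0 := by
  rw [← LinearMap.comp_apply, ← ModuleCat.hom_comp, A.C.d_comp_d]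
  rfl

/-- `Z^r_p`: the elements of `F_p` whose boundary lies in `F_{p-r}` (in degree `n`). -/
def Z (r p n : ℤ) : Submodule K (A.C.X n) :=
  A.F p n ⊓ (A.F (p - r) (n - 1)).comap (A.C.d n (n - 1)).hom

/-- `B^r_p = Z^{r-1}_{p-1} + ∂ Z^{r-1}_{p+r-1}` (in degree `n`). -/
def B (r p n : ℤ) : Submodule K (A.C.X n) :=
  A.Z (r - 1) (p - 1) n ⊔ (A.Z (r - 1) (p + r - 1) (n + 1)).map (A.C.d (n + 1) n).hom

theorem mem_Z {r p n m : ℤ} (h : m + 1 = n) {x : A.C.X n} :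
    x ∈ A.Z r p n ↔ x ∈ A.F p n ∧ (A.C.d n m).hom x ∈ A.F (p - r) m := by
  obtain rfl : m = n - 1 := by omega
  rfl

theorem mem_B {r p n m : ℤ} (h : n + 1 = m) {x : A.C.X n} :
    x ∈ A.B r p n ↔ ∃ a ∈ A.Z (r - 1) (p - 1) n, ∃ b ∈ A.Z (r - 1) (p + r - 1) m,
      a + (A.C.d m n).hom b = x := by
  subst h
  simp [B, Submodule.mem_sup]

theorem d_mem_Z {r p n m : ℤ} (r' : ℤ) (h : m + 1 = n) {x : A.C.X n} (hx : x ∈ A.Z r p n) :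
    (A.C.d n m).hom x ∈ A.Z r' (p - r) m :=
  (A.mem_Z (by omega : m - 1 + 1 = m)).2
    ⟨((A.mem_Z h).1 hx).2, by rw [A.d_d]; exact Submodule.zero_mem _⟩

theorem d_mem_B {r p n m : ℤ} (h : m + 1 = n) {x : A.C.X n} (hx : x ∈ A.B r p n) :
    (A.C.d n m).hom x ∈ A.B r (p - r) m := by
  obtain ⟨a, ha, b, -, rfl⟩ := (A.mem_B rfl).1 hx
  refine (A.mem_B h).2 ⟨0, Submodule.zero_mem _, a, ?_, ?_⟩
  · rwa [show p - r + r - 1 = p - 1 by ring]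
  · rw [map_add, A.d_d]; simp

/-- The term `E^r_{p,q} = Z^r_p / (Z^{r-1}_{p-1} + ∂ Z^{r-1}_{p+r-1})`, in degree `p + q`. -/
abbrev E (r : ℤ) (pq : ℤ × ℤ) : Type _ :=
  A.Z r pq.1 (pq.1 + pq.2) ⧸ (A.B r pq.1 (pq.1 + pq.2)).submoduleOf (A.Z r pq.1 (pq.1 + pq.2))

/-- The class in `E^r_{p,q}` of an element of `Z^r_p`. -/
def cls (r : ℤ) (pq : ℤ × ℤ) (x : A.C.X (pq.1 + pq.2)) (hx : x ∈ A.Z r pq.1 (pq.1 + pq.2)) :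
    A.E r pq := Submodule.Quotient.mk ⟨x, hx⟩

theorem cls_surj {r : ℤ} {pq : ℤ × ℤ} (e : A.E r pq) : ∃ x hx, A.cls r pq x hx = e := by
  obtain ⟨⟨x, hx⟩, rfl⟩ := Submodule.Quotient.mk_surjective _ e
  exact ⟨x, hx, rfl⟩

theorem cls_eq_cls {r : ℤ} {pq : ℤ × ℤ} {x y hx hy} :
    A.cls r pq x hx = A.cls r pq y hy ↔ x - y ∈ A.B r pq.1 (pq.1 + pq.2) :=
  Submodule.Quotient.eq _

theorem cls_eq_zero {r : ℤ} {pq : ℤ × ℤ} {x hx} :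
    A.cls r pq x hx = 0 ↔ x ∈ A.B r pq.1 (pq.1 + pq.2) :=
  Submodule.Quotient.mk_eq_zero _

open Classical in
/-- The differential of the `r`-th page, induced by `∂`. -/
noncomputable def pageD (r : ℤ) (pq pq' : ℤ × ℤ) : A.E r pq →ₗ[K] A.E r pq' :=
  if h : pq + (-r, r - 1) = pq' then
    Submodule.mapQ _ _ ((A.C.d (pq.1 + pq.2) (pq'.1 + pq'.2)).hom.restrict
      (fun x hx => by
        subst h
        exact A.d_mem_Z r (by simp; ring) hx))
      (fun x hx => by
        subst h
        exact A.d_mem_B (by simp; ring) hx)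
  else 0

theorem pageD_cls {r : ℤ} {pq pq' : ℤ × ℤ} (h : pq + (-r, r - 1) = pq') (x hx) :
    ∃ hx', A.pageD r pq pq' (A.cls r pq x hx) =
      A.cls r pq' ((A.C.d (pq.1 + pq.2) (pq'.1 + pq'.2)).hom x) hx' := by
  refine ⟨?_, ?_⟩
  · subst h
    exact A.d_mem_Z r (by simp; ring) hx
  · rw [pageD, dif_pos h]
    rfl

/-- The `r`-th page. -/
noncomputable def page (r : ℤ) :
    HomologicalComplex (ModuleCat K) (ComplexShape.up' ((-r, r - 1) : ℤ × ℤ)) where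
  X pq := ModuleCat.of K (A.E r pq)
  d pq pq' := ModuleCat.ofHom (A.pageD r pq pq')
  shape pq pq' h := by
    rw [pageD, dif_neg (show ¬ (pq + (-r, r - 1) = pq') from h)]
    rfl
  d_comp_d' i j k hij hjk := by
    refine ModuleCat.hom_ext (LinearMap.ext fun e => ?_)
    obtain ⟨x, hx, rfl⟩ := A.cls_surj e
    obtain ⟨hx', h1⟩ := A.pageD_cls hij x hx
    obtain ⟨hx'', h2⟩ := A.pageD_cls hjk _ hx'
    change A.pageD r j k (A.pageD r i j (A.cls r i x hx)) = 0
    rw [h1, h2, A.cls_eq_zero, A.d_d]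
    exact Submodule.zero_mem _

section Iso

variable (r : ℤ) (pq pq₁ pq₂ : ℤ × ℤ)

theorem Z_succ_le (r p n : ℤ) : A.Z (r + 1) p n ≤ A.Z r p n := fun _ hx =>
  ⟨hx.1, A.mono (by omega) _ hx.2⟩

theorem pageD_cls_succ (h₂ : pq + (-r, r - 1) = pq₂) (x)
    (hx : x ∈ A.Z (r + 1) pq.1 (pq.1 + pq.2)) :
    A.pageD r pq pq₂ (A.cls r pq x (A.Z_succ_le _ _ _ hx)) = 0 := by
  obtain ⟨hx', h⟩ := A.pageD_cls h₂ x (A.Z_succ_le _ _ _ hx)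
  rw [h, A.cls_eq_zero, A.mem_B rfl]
  refine ⟨_, ?_, 0, Submodule.zero_mem _, by rw [map_zero, add_zero]⟩
  have e₂ : pq₂.1 + pq₂.2 + 1 = pq.1 + pq.2 := by subst h₂; simp; ring
  rw [show pq₂.1 - 1 = pq.1 - (r + 1) by subst h₂; simp; ring]
  exact A.d_mem_Z (r - 1) e₂ hx

/-- The canonical map `E^{r+1}_{p,q} → ker d^r / im d^r`, which sends the class of `x ∈ Z^{r+1}_p`
to the homology class of the class of `x` in `E^r_{p,q}`. -/
noncomputable def nextPageToHomology (h₁ : pq₁ + (-r, r - 1) = pq) (h₂ : pq + (-r, r - 1) = pq₂) :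
    A.E (r + 1) pq →ₗ[K]
      (LinearMap.ker ((A.page r).sc' pq₁ pq pq₂).g.hom ⧸
        LinearMap.range ((A.page r).sc' pq₁ pq pq₂).moduleCatToCycles) :=
  Submodule.liftQ _
    ((LinearMap.range ((A.page r).sc' pq₁ pq pq₂).moduleCatToCycles).mkQ ∘ₗ
      LinearMap.codRestrict _
        ((((A.B r pq.1 (pq.1 + pq.2)).submoduleOf (A.Z r pq.1 (pq.1 + pq.2))).mkQ) ∘ₗ
          Submodule.inclusion (A.Z_succ_le r pq.1 (pq.1 + pq.2)))
        (fun x => A.pageD_cls_succ r pq pq₂ h₂ x.1 x.2))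
    (by
      rintro ⟨x, hx⟩ hxB
      obtain ⟨a, ha, b, hb, hab⟩ := (A.mem_B (m := pq₁.1 + pq₁.2)
        (by subst h₁; simp; ring)).1 (hxB : x ∈ A.B (r + 1) pq.1 _)
      rw [LinearMap.mem_ker, LinearMap.comp_apply, Submodule.mkQ_apply,
        Submodule.Quotient.mk_eq_zero]
      have hb' : b ∈ A.Z r pq₁.1 (pq₁.1 + pq₁.2) := by
        rwa [show r + 1 - 1 = r by ring, show pq.1 + (r + 1) - 1 = pq₁.1 by subst h₁; simp] at hb
      refine ⟨A.cls r pq₁ b hb', Subtype.ext ?_⟩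
      obtain ⟨hx', h⟩ := A.pageD_cls h₁ b hb'
      refine h.trans ((A.cls_eq_cls (hy := A.Z_succ_le _ _ _ hx)).2 ((A.mem_B rfl).2 ?_))
      refine ⟨-a, Submodule.neg_mem _ ?_, 0, Submodule.zero_mem _, ?_⟩
      · have := A.Z_succ_le (r - 1) (pq.1 - 1) (pq.1 + pq.2)
        rw [show r - 1 + 1 = r by ring] at this
        rw [show r + 1 - 1 = r by ring] at ha
        exact this ha
      · have hab' : a + _ = x := hab
        rw [map_zero, ← hab']; abel)

theorem nextPageToHomology_bijective
    (h₁ : pq₁ + (-r, r - 1) = pq) (h₂ : pq + (-r, r - 1) = pq₂) :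
    Function.Bijective (A.nextPageToHomology r pq pq₁ pq₂ h₁ h₂) := by
  have e₁ : pq.1 + pq.2 + 1 = pq₁.1 + pq₁.2 := by subst h₁; simp; ring
  have e₂ : pq₂.1 + pq₂.2 + 1 = pq.1 + pq.2 := by subst h₂; simp; ring
  have e₃ : pq₁.1 = pq.1 + r := by subst h₁; simp
  have e₄ : pq₂.1 = pq.1 - r := by subst h₂; simp; ring
  constructor
  · rw [injective_iff_map_eq_zero]
    intro e he
    obtain ⟨x, hx, rfl⟩ := A.cls_surj e
    have he' := (Submodule.Quotient.mk_eq_zero _).1 he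
    obtain ⟨f, hf⟩ := he'
    obtain ⟨y, hy, rfl⟩ := A.cls_surj f
    obtain ⟨hy', h⟩ := A.pageD_cls h₁ y hy
    have hf' : A.pageD r pq₁ pq (A.cls r pq₁ y hy) = A.cls r pq x (A.Z_succ_le _ _ _ hx) :=
      congrArg Subtype.val hf
    rw [h, A.cls_eq_cls, A.mem_B e₁] at hf'
    obtain ⟨a, ha, b, hb, hab⟩ := hf'
    have hb' : b ∈ A.Z r pq₁.1 (pq₁.1 + pq₁.2) := by
      refine ⟨A.mono (by omega) _ hb.1, A.mono (by omega) _ hb.2⟩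
    have hx1 : x = -a + (A.C.d (pq₁.1 + pq₁.2) (pq.1 + pq.2)).hom (y - b) := by
      rw [map_sub, eq_neg_add_iff_add_eq, eq_sub_iff_add_eq, ← sub_eq_zero]
      rw [← sub_eq_zero] at hab
      rw [← hab]; abel
    rw [A.cls_eq_zero, A.mem_B e₁]
    refine ⟨-a, ?_, y - b, ?_, hx1.symm⟩
    · rw [show r + 1 - 1 = r by ring]
      refine (A.mem_Z e₂).2 ⟨Submodule.neg_mem _ ha.1, ?_⟩
      have h3 := ((A.mem_Z e₂).1 hx).2
      rw [hx1, map_add, A.d_d, add_zero] at h3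
      rwa [show pq.1 - 1 - r = pq.1 - (r + 1) by ring]
    · have h4 := Submodule.sub_mem _ hy hb'
      rwa [show r + 1 - 1 = r by ring, show pq.1 + (r + 1) - 1 = pq₁.1 by omega]
  · intro c
    obtain ⟨⟨e, he⟩, rfl⟩ := Submodule.Quotient.mk_surjective _ c
    obtain ⟨x, hx, rfl⟩ := A.cls_surj (pq := pq) (r := r) e
    obtain ⟨hx', h⟩ := A.pageD_cls h₂ x hx
    have he' : A.pageD r pq pq₂ (A.cls r pq x hx) = 0 := he
    rw [h, A.cls_eq_zero, A.mem_B e₂] at he'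
    obtain ⟨a, ha, b, hb, hab⟩ := he'
    rw [show pq₂.1 + r - 1 = pq.1 - 1 by omega] at hb
    have hxb : x - b ∈ A.Z (r + 1) pq.1 (pq.1 + pq.2) := by
      refine (A.mem_Z e₂).2 ⟨Submodule.sub_mem _ hx.1 (A.mono (by omega) _ hb.1), ?_⟩
      rw [map_sub, ← hab, add_sub_cancel_right, show pq.1 - (r + 1) = pq₂.1 - 1 by omega]
      exact ha.1
    refine ⟨A.cls (r + 1) pq (x - b) hxb, congrArg _ (Subtype.ext ?_)⟩
    refine (A.cls_eq_cls (hx := A.Z_succ_le _ _ _ hxb)).2 ((A.mem_B rfl).2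
      ⟨-b, Submodule.neg_mem _ hb, 0, Submodule.zero_mem _, by rw [map_zero]; abel⟩)

end Iso

/-- The canonical isomorphism between the homology of the `r`-th page and the `(r+1)`-st page. -/
noncomputable def pageIso (r : ℤ) (pq : ℤ × ℤ) :
    (A.page r).homology pq ≅ (A.page (r + 1)).X pq :=
  have h₁ : pq - (-r, r - 1) + (-r, r - 1) = pq := sub_add_cancel _ _
  ShortComplex.homologyMapIso ((A.page r).isoSc' (pq - (-r, r - 1)) pq (pq + (-r, r - 1))
      (ComplexShape.prev_eq' _ h₁) (ComplexShape.next_eq' _ rfl)) ≪≫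
    ShortComplex.moduleCatHomologyIso _ ≪≫
    (LinearEquiv.ofBijective (A.nextPageToHomology r pq _ _ h₁ rfl)
      (A.nextPageToHomology_bijective r pq _ _ h₁ rfl)).toModuleIso.symm

/-- The spectral sequence of a filtered complex. -/
noncomputable def spectralSequence : HomologicalSpectralSequence.{v, w} K where
  page r _ := A.page r
  iso r r' pq h _ := A.pageIso r pq ≪≫ eqToIso (by subst h; rfl)

end FilteredComplex

/-- The morphisms `f i : S i ⟶ E` exhibit the spectral sequence `E` as the direct sum of the
finite family of spectral sequences `S i`: on each page and in each bidegree, the module `E^r_{p,q}`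
is the direct sum of the modules `(S i)^r_{p,q}`. (As the `f i` are morphisms of spectral
sequences, the differentials and the isomorphisms between the homology of a page and the next page
are then the direct sums of those of the `S i`.) -/
def IsDirectSumOfSpectralSequences {K : Type v} [CommRing K] {ι : Type*} [Fintype ι]
    (S : ι → HomologicalSpectralSequence.{v, w} K) (E : HomologicalSpectralSequence.{v, w} K)
    (f : ∀ i, S i ⟶ E) : Prop :=
  ∀ (r : ℤ) (hr : 1 ≤ r) (pq : ℤ × ℤ), Function.Bijective
    fun x : (∀ i, ((S i).page r hr).X pq) => ∑ i, (((f i).hom r hr).f pq).hom (x i)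

/-! ### The reachability complex and the magnitude-path spectral sequence -/

namespace Digraph

variable {V : Type u} (G : Digraph V)

/-- The tuples `(g_0, …, g_n)` of vertices without consecutive repetitions such that
`d(g_i, g_{i+1}) < ∞` (for `n < 0` there are none). They form the basis of `RC_n(G)`. -/
def IsReachTuple (n : ℤ) (t : List V) : Prop :=
  t ≠ [] ∧ (t.length : ℤ) = n + 1 ∧ t.IsChain fun g g' => g ≠ g' ∧ G.pathDist g g' < ⊤

/-- The length `L(g_0, …, g_n) = ∑ i, d(g_i, g_{i+1})` of a tuple. -/
noncomputable def tupleLength (t : List V) : ℕ∞ := (List.zipWith G.pathDist t t.tail).sum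

variable (K : Type v) [CommRing K]

/-- The degree `n` part of the reachability complex: the free module on the reachable tuples
`(g_0, …, g_n)` without consecutive repetitions. -/
abbrev RCMod (n : ℤ) : Type max u v := {t : List V // G.IsReachTuple n t} →₀ K

open Classical in
/-- A tuple, viewed as an element of `RC_n(G)`; all tuples which are not in the basis of `RC_n(G)`,
in particular those with a consecutive repetition, are identified with zero. -/
noncomputable def tupleClass (n : ℤ) (t : List V) : G.RCMod K n :=
  if h : G.IsReachTuple n t then Finsupp.single ⟨t, h⟩ 1 else 0

/-- The differential `∂(g_0, …, g_n) = ∑ i, (-1)^i (g_0, …, ĝ_i, …, g_n)`, as a map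
`RC_n(G) → RC_m(G)`, which is zero unless `n = m + 1`. -/
noncomputable def rcD (n m : ℤ) : G.RCMod K n →ₗ[K] G.RCMod K m :=
  Finsupp.linearCombination K fun t =>
    ∑ i ∈ Finset.range t.1.length, (-1 : K) ^ i • G.tupleClass K m (t.1.eraseIdx i)

variable {G K}

theorem rcD_single (n m : ℤ) (t : {t : List V // G.IsReachTuple n t}) :
    G.rcD K n m (Finsupp.single t 1) =
      ∑ i ∈ Finset.range t.1.length, (-1 : K) ^ i • G.tupleClass K m (t.1.eraseIdx i) := by
  simp [rcD]

variable (V K) in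
/-- The alternating sum of the faces of a tuple, in the free module on all tuples. -/
noncomputable def freeBd : (List V →₀ K) →ₗ[K] (List V →₀ K) :=
  Finsupp.linearCombination K fun t =>
    ∑ i ∈ Finset.range t.length, (-1 : K) ^ i • Finsupp.single (t.eraseIdx i) 1

variable (K) in
/-- Prepending a vertex to a tuple. -/
noncomputable def consMap (x : V) : (List V →₀ K) →ₗ[K] (List V →₀ K) :=
  Finsupp.lmapDomain K K (List.cons x)

variable (G K) in
/-- The projection onto the span of the basis tuples of `RC_n(G)`. -/
noncomputable def freeProj (n : ℤ) : (List V →₀ K) →ₗ[K] G.RCMod K n :=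
  Finsupp.linearCombination K (G.tupleClass K n)

theorem freeBd_nil : freeBd V K (Finsupp.single [] 1) = 0 := by simp [freeBd]

theorem freeBd_cons (x : V) (y : List V →₀ K) :
    freeBd V K (consMap K x y) = y - consMap K x (freeBd V K y) := by
  induction y using Finsupp.induction_linear with
  | zero => simp
  | add f g hf hg => rw [map_add, map_add, hf, hg, map_add, map_add]; abel
  | single t c =>
    rw [← mul_one c, ← smul_eq_mul, ← Finsupp.smul_single]
    simp only [map_smul, ← smul_sub]
    congr 1
    simp only [consMap, Finsupp.lmapDomain_apply, Finsupp.mapDomain_single, freeBd,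
      Finsupp.linearCombination_single, one_smul, List.length_cons, Finset.sum_range_succ',
      List.eraseIdx_cons_succ, List.eraseIdx_cons_zero, pow_zero, Finsupp.mapDomain_finsetSum,
      Finsupp.mapDomain_smul, pow_succ, mul_neg_one, neg_smul, Finset.sum_neg_distrib]
    abel

theorem freeBd_freeBd (y : List V →₀ K) : freeBd V K (freeBd V K y) = 0 := by
  have h : ∀ t : List V, freeBd V K (freeBd V K (Finsupp.single t 1)) = 0 := by
    intro t
    induction t with
    | nil => rw [freeBd_nil, map_zero]
    | cons x t ih =>
      have : Finsupp.single (x :: t) (1 : K) = consMap K x (Finsupp.single t 1) := by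
        simp [consMap]
      rw [this, freeBd_cons, map_sub, freeBd_cons, ih, map_zero]
      abel
  induction y using Finsupp.induction_linear with
  | zero => simp
  | add f g hf hg => simp [hf, hg]
  | single t c =>
    rw [← mul_one c, ← smul_eq_mul, ← Finsupp.smul_single, map_smul, map_smul, h, smul_zero]

variable (V K) in
/-- The span of the tuples with a consecutive repetition. -/
noncomputable def degen : Submodule K (List V →₀ K) :=
  Submodule.span K {y | ∃ t : List V, ¬ t.IsChain (· ≠ ·) ∧ y = Finsupp.single t 1}

theorem consMap_degen (x : V) {y : List V →₀ K} (hy : y ∈ degen V K) :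
    consMap K x y ∈ degen V K := by
  induction hy using Submodule.span_induction with
  | mem y hy =>
    obtain ⟨t, ht, rfl⟩ := hy
    refine Submodule.subset_span ⟨x :: t, fun h => ht h.tail, by simp [consMap]⟩
  | zero => simp
  | add f g _ _ hf hg => rw [map_add]; exact Submodule.add_mem _ hf hg
  | smul c f _ hf => rw [map_smul]; exact Submodule.smul_mem _ c hf

theorem consMap_consMap_degen (x : V) (y : List V →₀ K) :
    consMap K x (consMap K x y) ∈ degen V K := by
  induction y using Finsupp.induction_linear with
  | zero => simp
  | add f g hf hg => rw [map_add, map_add]; exact Submodule.add_mem _ hf hg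
  | single t c =>
    rw [← mul_one c, ← smul_eq_mul, ← Finsupp.smul_single, map_smul, map_smul]
    refine Submodule.smul_mem _ c (Submodule.subset_span ⟨x :: x :: t, by simp, by simp [consMap]⟩)

theorem freeBd_degen {y : List V →₀ K} (hy : y ∈ degen V K) : freeBd V K y ∈ degen V K := by
  have h : ∀ t : List V, ¬ t.IsChain (· ≠ ·) → freeBd V K (Finsupp.single t 1) ∈ degen V K := by
    intro t
    induction t with
    | nil => simp
    | cons x t ih =>
      intro ht
      have e : Finsupp.single (x :: t) (1 : K) = consMap K x (Finsupp.single t 1) := by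
        simp [consMap]
      rw [e, freeBd_cons]
      by_cases h : t.IsChain (· ≠ ·)
      · cases t with
        | nil => simp at ht
        | cons z t =>
          have hxz : x = z := by
            by_contra hne
            exact ht (List.isChain_cons_cons.2 ⟨hne, h⟩)
          subst hxz
          have e' : Finsupp.single (x :: t) (1 : K) = consMap K x (Finsupp.single t 1) := by
            simp [consMap]
          rw [e', freeBd_cons, map_sub, sub_sub_cancel]
          exact consMap_consMap_degen x _
      · exact Submodule.sub_mem _ (Submodule.subset_span ⟨t, h, rfl⟩) (consMap_degen x (ih h))
  induction hy using Submodule.span_induction with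
  | mem y hy => obtain ⟨t, ht, rfl⟩ := hy; exact h t ht
  | zero => simp
  | add f g _ _ hf hg => rw [map_add]; exact Submodule.add_mem _ hf hg
  | smul c f _ hf => rw [map_smul]; exact Submodule.smul_mem _ c hf

theorem freeProj_degen (n : ℤ) {y : List V →₀ K} (hy : y ∈ degen V K) :
    freeProj G K n y = 0 := by
  induction hy using Submodule.span_induction with
  | mem y hy =>
    obtain ⟨t, ht, rfl⟩ := hy
    simp only [freeProj, Finsupp.linearCombination_single, one_smul]
    exact dif_neg fun h => ht (h.2.2.imp fun _ _ h => h.1)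
  | zero => simp
  | add f g _ _ hf hg => rw [map_add, hf, hg, add_zero]
  | smul c f _ hf => rw [map_smul, hf, smul_zero]

theorem rcD_single' (n m : ℤ) (t : {t : List V // G.IsReachTuple n t}) :
    G.rcD K n m (Finsupp.single t 1) = freeProj G K m (freeBd V K (Finsupp.single t.1 1)) := by
  simp [rcD_single, freeBd, freeProj]

theorem reachable_eraseIdx {t : List V} (h : t.IsChain fun g g' => G.pathDist g g' < ⊤) (i : ℕ) :
    (t.eraseIdx i).IsChain fun g g' => G.pathDist g g' < ⊤ := by
  have : Trans (fun g g' => G.pathDist g g' < ⊤) (fun g g' => G.pathDist g g' < ⊤)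
      (fun g g' => G.pathDist g g' < ⊤) :=
    ⟨fun h1 h2 => (G.pathDist_triangle _ _ _).trans_lt (WithTop.add_lt_top.2 ⟨h1, h2⟩)⟩
  exact h.sublist (List.eraseIdx_sublist t i)

theorem rcD_tupleClass (m k : ℤ) {t : List V} (hlen : (t.length : ℤ) = m + 1)
    (h : t.IsChain fun g g' => G.pathDist g g' < ⊤) :
    G.rcD K m k (G.tupleClass K m t) = freeProj G K k (freeBd V K (Finsupp.single t 1)) := by
  by_cases ht : G.IsReachTuple m t
  · rw [tupleClass, dif_pos ht, rcD_single']
  · rw [tupleClass, dif_neg ht, map_zero]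
    by_cases h0 : t = []
    · subst h0; rw [freeBd_nil, map_zero]
    · refine (freeProj_degen k (freeBd_degen (Submodule.subset_span ⟨t, fun hc => ht ⟨h0, hlen, ?_⟩, rfl⟩))).symm
      rw [List.isChain_iff_getElem] at hc h ⊢
      exact fun i hi => ⟨hc i hi, h i hi⟩

theorem rcD_rcD (n m k : ℤ) (hnm : m + 1 = n) (x : G.RCMod K n) :
    G.rcD K m k (G.rcD K n m x) = 0 := by
  induction x using Finsupp.induction_linear with
  | zero => simp
  | add f g hf hg => simp [hf, hg]
  | single t c =>
    rw [← mul_one c, ← smul_eq_mul, ← Finsupp.smul_single, map_smul, map_smul]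
    have : G.rcD K m k (G.rcD K n m (Finsupp.single t 1)) =
        freeProj G K k (freeBd V K (freeBd V K (Finsupp.single t.1 1))) := by
      rw [rcD_single, freeBd, Finsupp.linearCombination_single, one_smul]
      simp only [map_sum, map_smul]
      refine Finset.sum_congr rfl fun i hi => ?_
      rw [rcD_tupleClass]
      · rfl
      · have h1 := List.length_eraseIdx_of_lt (Finset.mem_range.1 hi)
        have h2 := t.2.2.1
        have h3 := Finset.mem_range.1 hi
        omega
      · exact reachable_eraseIdx (t.2.2.2.imp fun _ _ h => h.2) i
    rw [this, freeBd_freeBd, map_zero, smul_zero]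

theorem tupleClass_of_ne {n : ℤ} {t : List V} (h : (t.length : ℤ) ≠ n + 1) :
    G.tupleClass K n t = 0 :=
  dif_neg fun h' => h h'.2.1

theorem rcD_shape (n m : ℤ) (h : m + 1 ≠ n) : G.rcD K n m = 0 := by
  refine Finsupp.lhom_ext' fun t => LinearMap.ext_ring ?_
  rw [LinearMap.comp_apply, Finsupp.lsingle_apply, rcD_single]
  refine Finset.sum_eq_zero fun i hi => ?_
  rw [tupleClass_of_ne, smul_zero]
  have h1 := List.length_eraseIdx_of_lt (Finset.mem_range.1 hi)
  have h2 := t.2.2.1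
  have h3 := Finset.mem_range.1 hi
  omega

theorem tupleLength_cons_cons (a b : V) (t : List V) :
    G.tupleLength (a :: b :: t) = G.pathDist a b + G.tupleLength (b :: t) := by
  simp [tupleLength]

theorem tupleLength_eraseIdx_le (t : List V) (i : ℕ) :
    G.tupleLength (t.eraseIdx i) ≤ G.tupleLength t := by
  induction t generalizing i with
  | nil => simp
  | cons a t ih =>
    cases t with
    | nil => cases i <;> simp [tupleLength]
    | cons b t =>
      match i with
      | 0 =>
        rw [List.eraseIdx_cons_zero, tupleLength_cons_cons]
        exact le_add_self
      | 1 =>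
        rw [List.eraseIdx_cons_succ, List.eraseIdx_cons_zero]
        cases t with
        | nil => simp [tupleLength]
        | cons c t =>
          simp only [tupleLength_cons_cons, ← add_assoc]
          gcongr
          exact G.pathDist_triangle a b c
      | i + 2 =>
        have := ih (i + 1)
        rw [List.eraseIdx_cons_succ] at this
        rw [List.eraseIdx_cons_succ, List.eraseIdx_cons_succ, tupleLength_cons_cons,
          tupleLength_cons_cons]
        gcongr

variable (G K) in
/-- The term `F_ℓ RC_n(G)` of the filtration: the submodule generated by the basis tuples with
`L(g_0, …, g_n) ≤ ℓ`. -/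
noncomputable def rcFiltration (l n : ℤ) : Submodule K (G.RCMod K n) :=
  Submodule.span K {x | ∃ t : {t : List V // G.IsReachTuple n t},
    (∃ k : ℕ, G.tupleLength t.1 = k ∧ (k : ℤ) ≤ l) ∧ x = Finsupp.single t 1}

theorem rcD_mem_rcFiltration {l n : ℤ} (m : ℤ) {x : G.RCMod K n}
    (hx : x ∈ G.rcFiltration K l n) : G.rcD K n m x ∈ G.rcFiltration K l m := by
  induction hx using Submodule.span_induction with
  | mem x hx =>
    obtain ⟨t, ⟨k, hk, hkl⟩, rfl⟩ := hx
    rw [rcD_single]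
    refine Submodule.sum_mem _ fun i _ => Submodule.smul_mem _ _ ?_
    rw [tupleClass]
    split_ifs with h
    · have hle := (G.tupleLength_eraseIdx_le t.1 i).trans_eq hk
      obtain ⟨k', hk'⟩ := ENat.ne_top_iff_exists.1 (ne_top_of_le_ne_top (ENat.natCast_ne_top k) hle)
      rw [← hk'] at hle
      have : k' ≤ k := by exact_mod_cast hle
      exact Submodule.subset_span ⟨⟨_, h⟩, ⟨k', hk'.symm, by omega⟩, rfl⟩
    · exact Submodule.zero_mem _
  | zero => simp
  | add f g _ _ hf hg => rw [map_add]; exact Submodule.add_mem _ hf hg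
  | smul c f _ hf => rw [map_smul]; exact Submodule.smul_mem _ c hf

variable (G K)

/-- The reachability complex `RC(G)` with coefficients in `K`, with its filtration by length. -/
noncomputable def reachabilityComplex : FilteredComplex.{v, max u v} K where
  C :=
    { X n := ModuleCat.of K (G.RCMod K n)
      d n m := ModuleCat.ofHom (G.rcD K n m)
      shape n m h := by
        rw [rcD_shape n m h]
        rfl
      d_comp_d' n m k hnm _ := ModuleCat.hom_ext (LinearMap.ext fun x => rcD_rcD n m k hnm x) }
  F l n := G.rcFiltration K l n
  mono h n := Submodule.span_mono fun _ ⟨t, ⟨k, hk, hkl⟩, hx⟩ => ⟨t, ⟨k, hk, hkl.trans h⟩, hx⟩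
  d_mem m _ hx := rcD_mem_rcFiltration m hx

/-- The magnitude-path spectral sequence `E(G)` with coefficients in `K`. -/
noncomputable def magnitudePathSS : HomologicalSpectralSequence.{v, max u v} K :=
  (G.reachabilityComplex K).spectralSequence

/-- The `r`-minimal model `M_r(G)` of a finite digraph, as a full subdigraph of `G`. -/
noncomputable def minimalModel [Finite V] (r : ℝ≥0) : Digraph (G.toQuasimetric.minimalModel r) :=
  G.inducedOn (G.toQuasimetric.minimalModel r)

theorem minimalModel_isMinimalModel [Finite V] (r : ℝ≥0) :
    (G.minimalModel r).toQuasimetric.IsMinimalModel r G.toQuasimetric := by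
  rw [minimalModel,
    G.toQuasimetric_inducedOn (G.toQuasimetric.minimalModel_isDeformationRetract r)]
  exact G.toQuasimetric.minimalModel_isMinimalModel r

/-- The stable model `M_stab(G)` of a finite digraph, as a full subdigraph of `G`. -/
noncomputable def stableModel [Finite V] : Digraph G.toQuasimetric.stableModel :=
  G.inducedOn G.toQuasimetric.stableModel

end Digraph

/-!
The decomposition comes from a decreasing sequence of commuting idempotents.

For a finite quasimetric space there are short idempotent self-maps `e_0 = 1, e_1, e_2, …` such that
`e_s ∘ e_r = e_max(r, s)`, such that `e_r` is `r`-homotopic to the identity, and such that the image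
of `e_r` is `r`-minimal (`minIdem`). In an `r`-minimal space a short self-map `r`-homotopic to the
identity has finite order, so every `r`-minimal model is isometric to the image of `e_r`
(`IsMinimalModel.exists_splitting`). As the distances of a digraph are integers, its jumping points
are the integers `i + 1` at which the cardinality of the image of `e_i` drops
(`mem_jumpingPoints_iff`), and `e_{i+1} = e_i` for all other `i`.

Short maps induce filtered chain maps of the reachability complexes. The prism operator of two short
maps at distance at most `r` is a chain homotopy that raises the filtration by at most `r`; hence
`r`-homotopic maps agree on the page `E^{r+1}` (`sub_mem_B_of_homotopic`).

So the idempotents `P_r` of `RC(G)` induced by the `e_r` give filtered idempotents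
`P_{r_k - 1} - P_{r_k}`, one for each jumping point, and the eventual value `P_∞` of the sequence.
They are orthogonal and add up to the identity, and those belonging to the jumping points after
`r_j`, together with `P_∞`, add up to `P_{r_j}` (`sum_idempotentJump`). Splitting them, with the
induced filtrations, decomposes `RC(G)`, as well as `RC(H)` for every `r_j`-minimal model `H`, and a
decomposition of a filtered complex decomposes its spectral sequence (`isDirectSum_spectralMap`).
The `k`-th summand dies on the page `E^{r_k+1}`, since both `P_{r_k - 1}` and `P_{r_k}` induce the
identity there.
-/

/-! ### Short self-maps, minimal idempotents and minimal models -/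

namespace Quasimetric

variable {X Y Z : Type*}

instance (D : Quasimetric X) : Monoid (ShortMap D D) where
  mul f g := ShortMap.comp f g
  one := D.idMap
  mul_assoc _ _ _ := rfl
  one_mul _ := rfl
  mul_one _ := rfl

theorem ShortMap.mul_eq_comp {D : Quasimetric X} (f g : ShortMap D D) : f * g = f.comp g := rfl

theorem ShortMap.one_eq_idMap (D : Quasimetric X) : (1 : ShortMap D D) = D.idMap := rfl

instance [Finite X] (D : Quasimetric X) : Finite (ShortMap D D) :=
  inferInstanceAs (Finite (Subtype _))

theorem Homotopic.refl {D : Quasimetric X} {E : Quasimetric Y} (r : ℝ≥0) (φ : ShortMap D E) :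
    Homotopic r φ φ := Relation.ReflTransGen.refl

theorem Homotopic.trans {D : Quasimetric X} {E : Quasimetric Y} {r : ℝ≥0} {φ ψ χ : ShortMap D E}
    (h : Homotopic r φ ψ) (h' : Homotopic r ψ χ) : Homotopic r φ χ :=
  Relation.ReflTransGen.trans h h'

theorem Homotopic.symm {D : Quasimetric X} {E : Quasimetric Y} {r : ℝ≥0} {φ ψ : ShortMap D E}
    (h : Homotopic r φ ψ) : Homotopic r ψ φ :=
  have : Std.Symm fun x y => (onShortMaps D E).d x y ≤ r ∨ (onShortMaps D E).d y x ≤ r :=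
    ⟨fun _ _ h => h.symm⟩
  Relation.ReflTransGen.stdSymm.symm _ _ h

theorem Homotopic.mono {D : Quasimetric X} {E : Quasimetric Y} {r s : ℝ≥0} (hrs : r ≤ s)
    {φ ψ : ShortMap D E} (h : Homotopic r φ ψ) : Homotopic s φ ψ :=
  have hrs' : (r : ℝ≥0∞) ≤ s := by exact_mod_cast hrs
  Relation.ReflTransGen.mono
    (fun _ _ h => h.imp (fun h => h.trans hrs') (fun h => h.trans hrs')) _ _ h

theorem Homotopic.eq_of_zero {D : Quasimetric X} {E : Quasimetric Y} {φ ψ : ShortMap D E}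
    (h : Homotopic 0 φ ψ) : φ = ψ := by
  induction h with
  | refl => rfl
  | tail _ h ih =>
    simp only [ENNReal.coe_zero, nonpos_iff_eq_zero, (onShortMaps D E).d_eq_zero_iff] at h
    rcases h with rfl | rfl <;> exact ih

theorem Homotopic.mul {D : Quasimetric X} {r : ℝ≥0} {φ φ' ψ ψ' : ShortMap D D}
    (h : Homotopic r φ φ') (h' : Homotopic r ψ ψ') : Homotopic r (φ * ψ) (φ' * ψ') :=
  (h'.comp_left φ).trans (h.comp_right ψ')

theorem Homotopic.pow_one {D : Quasimetric X} {r : ℝ≥0} {φ : ShortMap D D}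
    (h : Homotopic r φ 1) (n : ℕ) : Homotopic r (φ ^ n) 1 := by
  induction n with
  | zero => exact .refl _ _
  | succ n ih => rw [pow_succ]; simpa using ih.mul h

/-- Some positive power of an element of a finite monoid is idempotent. -/
theorem exists_isIdempotentElem_pow {M : Type*} [Monoid M] [Finite M] (a : M) :
    ∃ n, 0 < n ∧ IsIdempotentElem (a ^ n) := by
  obtain ⟨i, j, hij, h⟩ := Finite.exists_ne_map_eq_of_infinite (fun n : ℕ => a ^ n)
  wlog hlt : i < j generalizing i j
  · exact this j i hij.symm h.symm (by omega)
  obtain ⟨d, rfl⟩ := Nat.exists_eq_add_of_lt hlt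
  have h1 : ∀ m, i ≤ m → ∀ c, a ^ (m + c * (d + 1)) = a ^ m := by
    intro m hm c
    obtain ⟨b, rfl⟩ := Nat.exists_eq_add_of_le hm
    induction c with
    | zero => simp
    | succ c ih =>
      calc a ^ (i + b + (c + 1) * (d + 1))
          = a ^ (i + d + 1) * a ^ (b + c * (d + 1)) := by rw [← pow_add]; congr 1; ring
        _ = a ^ i * a ^ (b + c * (d + 1)) := by rw [← show a ^ i = a ^ (i + d + 1) from h]
        _ = a ^ (i + b) := by rw [← pow_add, ← ih]; congr 1; ring
  refine ⟨(i + 1) * (d + 1), by positivity, ?_⟩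
  rw [IsIdempotentElem, ← pow_add]
  exact h1 _ (by nlinarith) _

/-- In an `r`-minimal space, a short self-map `r`-homotopic to the identity has finite order: its
idempotent powers are retractions onto `r`-deformation retracts. -/
theorem IsMinimal.exists_pow_eq_one {E : Quasimetric Y} {r : ℝ≥0} (hE : IsMinimal r E)
    {f : ShortMap E E} (hf : Homotopic r f 1) : ∃ n, f ^ (n + 1) = 1 := by
  have := hE.1
  obtain ⟨n, hn, hid⟩ := exists_isIdempotentElem_pow f
  obtain ⟨n, rfl⟩ := Nat.exists_eq_add_of_lt hn
  rw [zero_add] at hid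
  refine ⟨n, ?_⟩
  set p := f ^ (n + 1) with hp
  have hpp : ∀ y, p.1 (p.1 y) = p.1 y := fun y => congrFun (congrArg Subtype.val hid) y
  have huniv : Set.range p.1 = Set.univ := by
    refine hE.2 _ ⟨⟨fun y => ⟨p.1 y, y, rfl⟩, p.2⟩, ?_, hf.pow_one (n + 1)⟩
    apply Subtype.ext
    funext ⟨_, y, rfl⟩
    exact Subtype.ext (hpp y)
  apply Subtype.ext
  funext y
  obtain ⟨z, rfl⟩ : y ∈ Set.range p.1 := huniv ▸ Set.mem_univ y
  exact hpp z

/-- The counterpart of `r`-minimality for the image of an idempotent short self-map `e`: no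
idempotent other than `e` itself retracts the image of `e` within the `r`-homotopy class of `e`. -/
def IsMinimalIdempotent (r : ℝ≥0) {D : Quasimetric X} (e : ShortMap D D) : Prop :=
  ∀ f : ShortMap D D, f * f = f → e * f = f → f * e = f → Homotopic r f e → f = e

theorem range_eq_of_mul_eq {D : Quasimetric X} {e f : ShortMap D D}
    (h : e * f = f) : Set.range f.1 ⊆ Set.range e.1 := by
  rintro _ ⟨x, rfl⟩
  exact ⟨f.1 x, congrFun (congrArg Subtype.val h) x⟩

/-- Of two idempotents, one absorbing the other, with images of the same finite cardinality, both
agree. -/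
theorem eq_of_ncard_range_le [Finite X] {D : Quasimetric X} {e f : ShortMap D D}
    (hf : f * f = f) (hef : e * f = f) (hfe : f * e = f)
    (h : (Set.range e.1).ncard ≤ (Set.range f.1).ncard) : f = e := by
  have hr : Set.range f.1 = Set.range e.1 :=
    Set.eq_of_subset_of_ncard_le (range_eq_of_mul_eq hef) h (Set.toFinite _)
  apply Subtype.ext
  funext x
  obtain ⟨y, hy⟩ : e.1 x ∈ Set.range f.1 := hr ▸ Set.mem_range_self x
  calc f.1 x = f.1 (e.1 x) := (congrFun (congrArg Subtype.val hfe) x).symm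
    _ = f.1 (f.1 y) := by rw [hy]
    _ = f.1 y := congrFun (congrArg Subtype.val hf) y
    _ = e.1 x := hy

/-- A minimal idempotent below `e`: one with an image of least cardinality. -/
theorem exists_isMinimalIdempotent [Finite X] {D : Quasimetric X} (r : ℝ≥0) {e : ShortMap D D}
    (he : e * e = e) :
    ∃ f : ShortMap D D, f * f = f ∧ e * f = f ∧ f * e = f ∧ Homotopic r f e ∧
      IsMinimalIdempotent r f := by
  let s : Set (ShortMap D D) := {f | f * f = f ∧ e * f = f ∧ f * e = f ∧ Homotopic r f e}
  obtain ⟨f, hf, hmin⟩ := Set.exists_min_image s (fun f => (Set.range f.1).ncard) s.toFinite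
    ⟨e, he, he, he, .refl _ _⟩
  refine ⟨f, hf.1, hf.2.1, hf.2.2.1, hf.2.2.2, fun g hg hfg hgf hh => ?_⟩
  refine eq_of_ncard_range_le hg hfg hgf (hmin g ⟨hg, ?_, ?_, hh.trans hf.2.2.2⟩)
  · rw [← hfg, ← mul_assoc, hf.2.1]
  · rw [← hgf, mul_assoc, hf.2.2.1]

/-- Every `r`-minimal model is isometric to the image of a given minimal idempotent
`r`-homotopic to the identity; in particular the `r`-minimal model is unique up to isometry. -/
theorem IsMinimalModel.exists_splitting {D : Quasimetric X} {E : Quasimetric Y} {r : ℝ≥0}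
    (h : IsMinimalModel r E D) {e : ShortMap D D} (he : e * e = e) (he1 : Homotopic r e 1)
    (hmin : IsMinimalIdempotent r e) :
    ∃ (α : ShortMap D E) (β : ShortMap E D), α.comp β = 1 ∧ β.comp α = e := by
  obtain ⟨hE, φ, ψ, h1, h2⟩ := h
  -- `a ∘ b` has finite order by minimality of `E`; correcting `b` by its inverse makes `a` a
  -- retraction of `b`, and then `b ∘ a` is an idempotent absorbed by `e`.
  let a : ShortMap D E := φ.comp e
  let b : ShortMap E D := e.comp ψ
  have hab : Homotopic r (a.comp b) 1 :=
    ((((he1.mul he1).comp_right ψ).comp_left φ)).trans h2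
  have hba : Homotopic r (b.comp a) e := by
    have := (Homotopic.refl r e).mul (h1.mul (Homotopic.refl r e))
    exact this.trans (by rw [← ShortMap.one_eq_idMap, one_mul, he]; exact .refl _ _)
  obtain ⟨n, hn⟩ := hE.exists_pow_eq_one hab
  have hpow : ∀ m, b.comp (((a.comp b) ^ m).comp a) = (b.comp a) ^ (m + 1) := by
    intro m
    induction m with
    | zero => rw [pow_zero, zero_add, pow_one]; rfl
    | succ m ih => rw [pow_succ' _ (m + 1), ← ih, pow_succ']; rfl
  have hhom : ∀ m, Homotopic r ((b.comp a) ^ (m + 1)) e := by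
    intro m
    induction m with
    | zero => rwa [zero_add, pow_one]
    | succ m ih => rw [pow_succ, ← he]; exact ih.mul hba
  have h1' : ((a.comp b) ^ n).comp (a.comp b) = 1 := by rw [← hn, pow_succ]; rfl
  have h2' : (a.comp b).comp ((a.comp b) ^ n) = 1 := by rw [← hn, pow_succ']; rfl
  refine ⟨a, b.comp ((a.comp b) ^ n), h2', hmin _ ?_ ?_ ?_ ?_⟩
  · change (b.comp ((a.comp b) ^ n)).comp (((a.comp b).comp ((a.comp b) ^ n)).comp a) = _
    rw [h2']
    rfl
  · change ((e * e).comp ψ).comp (((a.comp b) ^ n).comp a) = _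
    rw [he]; rfl
  · change (b.comp ((a.comp b) ^ n)).comp (φ.comp (e * e)) = _
    rw [he]
  · exact (congrArg (Homotopic r · e) (hpow n)).mpr (hhom n)

/-! ### A compatible system of minimal idempotents -/

section Sequence

variable [Finite X] (D : Quasimetric X)

/-- A sequence of idempotent short self-maps: it starts with the identity, and for `r ≥ 1` the image
of the `r`-th one is an `r`-minimal deformation retract of the image of the previous one. -/
noncomputable def minIdem : ℕ → {e : ShortMap D D // e * e = e}
  | 0 => ⟨1, one_mul 1⟩
  | r + 1 => ⟨(exists_isMinimalIdempotent ((r + 1 : ℕ) : ℝ≥0) (minIdem r).2).choose,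
      (exists_isMinimalIdempotent ((r + 1 : ℕ) : ℝ≥0) (minIdem r).2).choose_spec.1⟩

theorem minIdem_zero : (D.minIdem 0).1 = 1 := by rw [minIdem]

theorem minIdem_succ (r : ℕ) :
    (D.minIdem r).1 * (D.minIdem (r + 1)).1 = (D.minIdem (r + 1)).1 ∧
    (D.minIdem (r + 1)).1 * (D.minIdem r).1 = (D.minIdem (r + 1)).1 ∧
    Homotopic ((r + 1 : ℕ) : ℝ≥0) (D.minIdem (r + 1)).1 (D.minIdem r).1 ∧
    IsMinimalIdempotent ((r + 1 : ℕ) : ℝ≥0) (D.minIdem (r + 1)).1 := by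
  rw [minIdem]
  exact (exists_isMinimalIdempotent ((r + 1 : ℕ) : ℝ≥0) (D.minIdem r).2).choose_spec.2

theorem minIdem_mul {r s : ℕ} (h : r ≤ s) :
    (D.minIdem r).1 * (D.minIdem s).1 = (D.minIdem s).1 ∧
    (D.minIdem s).1 * (D.minIdem r).1 = (D.minIdem s).1 := by
  induction s, h using Nat.le_induction with
  | base => exact ⟨(D.minIdem r).2, (D.minIdem r).2⟩
  | succ s _ ih =>
    obtain ⟨h1, h2, -⟩ := D.minIdem_succ s
    exact ⟨by rw [← h1, ← mul_assoc, ih.1], by rw [← h2, mul_assoc, ih.2]⟩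

theorem minIdem_homotopic (r : ℕ) : Homotopic (r : ℝ≥0) (D.minIdem r).1 1 := by
  induction r with
  | zero => rw [minIdem_zero]; exact .refl _ _
  | succ r ih =>
    exact (D.minIdem_succ r).2.2.1.trans (ih.mono (by exact_mod_cast r.le_succ))

theorem minIdem_isMinimal (r : ℕ) : IsMinimalIdempotent (r : ℝ≥0) (D.minIdem r).1 := by
  cases r with
  | zero => exact fun f _ _ _ h => Homotopic.eq_of_zero (by simpa using h)
  | succ r => exact (D.minIdem_succ r).2.2.2

/-- The cardinality of the image of the `r`-th idempotent, that is of the `r`-minimal model. -/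
noncomputable def modelCard (r : ℕ) : ℕ := (Set.range (D.minIdem r).1.1).ncard

theorem modelCard_antitone : Antitone D.modelCard := fun _ _ h =>
  Set.ncard_le_ncard (range_eq_of_mul_eq (D.minIdem_mul h).1) (Set.toFinite _)

theorem minIdem_succ_eq {r : ℕ} (h : D.modelCard r ≤ D.modelCard (r + 1)) :
    (D.minIdem (r + 1)).1 = (D.minIdem r).1 :=
  eq_of_ncard_range_le (D.minIdem (r + 1)).2 (D.minIdem_succ r).1 (D.minIdem_succ r).2.1 h

theorem finite_modelCard_lt : {r : ℕ | D.modelCard (r + 1) < D.modelCard r}.Finite := by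
  refine Set.Finite.of_finite_image (f := D.modelCard)
    ((Set.finite_Iic (D.modelCard 0)).subset ?_) ?_
  · rintro _ ⟨r, -, rfl⟩
    exact D.modelCard_antitone r.zero_le
  · refine StrictAntiOn.injOn fun r hr s _ hrs => ?_
    exact (D.modelCard_antitone (Nat.succ_le_of_lt hrs)).trans_lt hr

end Sequence

end Quasimetric

/-! ### Minimal models and jumping points of digraphs -/

namespace Digraph

open Quasimetric

variable {V : Type u} {W : Type w} (G : Digraph V)

/-- Since the distances of a digraph are integers, they do not distinguish `r` from `⌊r⌋`. -/
theorem toENNReal_le_coe_iff (x : ℕ∞) (r : ℝ≥0) :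
    (x : ℝ≥0∞) ≤ r ↔ x ≤ (⌊r⌋₊ : ℕ∞) := by
  induction x using ENat.recTopCoe with
  | top => simp
  | coe n =>
    rw [ENat.toENNReal_coe, Nat.cast_le, Nat.le_floor_iff zero_le]
    exact_mod_cast Iff.rfl

theorem onShortMaps_le_iff {H : Digraph W} (r : ℝ≥0)
    (φ ψ : ShortMap G.toQuasimetric H.toQuasimetric) :
    (onShortMaps G.toQuasimetric H.toQuasimetric).d φ ψ ≤ r ↔
      ∀ x, H.pathDist (φ.1 x) (ψ.1 x) ≤ (⌊r⌋₊ : ℕ∞) := by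
  simp only [onShortMaps, iSup_le_iff]
  exact forall_congr' fun x => toENNReal_le_coe_iff _ _

theorem homotopic_floor {H : Digraph W} {r : ℝ≥0}
    {φ ψ : ShortMap G.toQuasimetric H.toQuasimetric} (h : Homotopic r φ ψ) :
    Homotopic (⌊r⌋₊ : ℝ≥0) φ ψ := by
  refine Relation.ReflTransGen.mono (fun f g h => ?_) _ _ h
  rw [onShortMaps_le_iff, onShortMaps_le_iff] at h ⊢
  rwa [Nat.floor_natCast]

variable [Finite V]

theorem exists_splitting {H : Digraph W} {r : ℝ≥0}
    (h : IsMinimalModel r H.toQuasimetric G.toQuasimetric) :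
    ∃ (α : ShortMap G.toQuasimetric H.toQuasimetric)
      (β : ShortMap H.toQuasimetric G.toQuasimetric),
      α.comp β = 1 ∧ β.comp α = (G.toQuasimetric.minIdem ⌊r⌋₊).1 :=
  h.exists_splitting (G.toQuasimetric.minIdem _).2
    ((G.toQuasimetric.minIdem_homotopic _).mono (Nat.floor_le zero_le))
    fun f h1 h2 h3 h4 => G.toQuasimetric.minIdem_isMinimal _ f h1 h2 h3 (G.homotopic_floor h4)

theorem card_minimalModel (r : ℝ≥0) :
    Nat.card (G.toQuasimetric.minimalModel r) = G.toQuasimetric.modelCard ⌊r⌋₊ := by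
  obtain ⟨α, β, h1, h2⟩ := G.exists_splitting (G.minimalModel_isMinimalModel r)
  have hinj : Function.Injective β.1 :=
    Function.LeftInverse.injective fun x => congrFun (congrArg Subtype.val h1) x
  have hsurj : Function.Surjective α.1 := fun y =>
    ⟨β.1 y, congrFun (congrArg Subtype.val h1) y⟩
  rw [modelCard, ← h2, show (β.comp α).1 = β.1 ∘ α.1 from rfl, hsurj.range_comp,
    ← Nat.card_coe_set_eq]
  exact Nat.card_congr (Equiv.ofInjective _ hinj)

/-- The jumping points are the positive integers at which the cardinality of the minimal model
drops: distances in a digraph are integers, so the `r`-minimal model depends on `⌊r⌋` only. -/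
theorem mem_jumpingPoints_iff (r : ℝ≥0) :
    r ∈ G.toQuasimetric.jumpingPoints ↔
      ∃ n : ℕ, G.toQuasimetric.modelCard (n + 1) < G.toQuasimetric.modelCard n ∧
        r = ((n + 1 : ℕ) : ℝ≥0) := by
  have key : ∀ s t : ℝ≥0, G.toQuasimetric.cardRatio s < G.toQuasimetric.cardRatio t ↔
      G.toQuasimetric.modelCard ⌊s⌋₊ < G.toQuasimetric.modelCard ⌊t⌋₊ := by
    intro s t
    rw [cardRatio, cardRatio, card_minimalModel, card_minimalModel]
    rcases isEmpty_or_nonempty V with h | h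
    · have : ∀ n, G.toQuasimetric.modelCard n = 0 := fun n => by
        rw [modelCard, Set.range_eq_empty, Set.ncard_empty]
      simp [this]
    · rw [div_lt_div_iff_of_pos_right (by exact_mod_cast Nat.card_pos)]
      exact Nat.cast_lt
  simp only [jumpingPoints, Set.mem_ofPred_eq, key]
  constructor
  · rintro ⟨hpos, h⟩
    have hfl : (⌊r⌋₊ : ℝ≥0) = r := by
      by_contra hne
      have := h _ (lt_of_le_of_ne (Nat.floor_le zero_le) hne)
      rw [Nat.floor_natCast] at this
      exact lt_irrefl _ this
    obtain ⟨n, hn⟩ : ∃ n, ⌊r⌋₊ = n + 1 := by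
      refine Nat.exists_eq_succ_of_ne_zero fun h0 => ?_
      rw [h0, Nat.cast_zero] at hfl
      exact hpos.ne hfl
    have := h n (by rw [← hfl, hn]; exact_mod_cast n.lt_succ_self)
    rw [hn, Nat.floor_natCast] at this
    exact ⟨n, this, by rw [← hn, hfl]⟩
  · rintro ⟨n, hn, rfl⟩
    refine ⟨by positivity, fun s hs => ?_⟩
    rw [Nat.floor_natCast]
    refine hn.trans_le (G.toQuasimetric.modelCard_antitone ?_)
    have := (Nat.floor_lt zero_le).2 hs
    omega

end Digraph

/-! ### Functoriality of the spectral sequence of a filtered complex -/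

namespace FilteredComplex

variable {K : Type v} [CommRing K] {A B C : FilteredComplex.{v, w} K}

/-- A morphism of the underlying chain complexes is filtered if it maps `F_p` to `F_p`. -/
def IsFiltered (φ : A.C ⟶ B.C) : Prop :=
  ∀ (p n : ℤ), A.F p n ≤ (B.F p n).comap (φ.f n).hom

theorem IsFiltered.comp {φ : A.C ⟶ B.C} {ψ : B.C ⟶ C.C} (hφ : IsFiltered φ) (hψ : IsFiltered ψ) :
    IsFiltered (φ ≫ ψ) := fun p n _ h => hψ p n (hφ p n h)

theorem hom_d (φ : A.C ⟶ B.C) (n m : ℤ) (x : A.C.X n) :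
    (B.C.d n m).hom ((φ.f n).hom x) = (φ.f m).hom ((A.C.d n m).hom x) := by
  rw [← LinearMap.comp_apply, ← ModuleCat.hom_comp, φ.comm, ModuleCat.hom_comp,
    LinearMap.comp_apply]

theorem IsFiltered.map_Z {φ : A.C ⟶ B.C} (hφ : IsFiltered φ) {r p n : ℤ} {x : A.C.X n}
    (hx : x ∈ A.Z r p n) : (φ.f n).hom x ∈ B.Z r p n := by
  refine ⟨hφ p n hx.1, ?_⟩
  rw [Submodule.comap_coe, Set.mem_preimage, hom_d]
  exact hφ _ _ hx.2

theorem IsFiltered.map_B {φ : A.C ⟶ B.C} (hφ : IsFiltered φ) {r p n : ℤ} {x : A.C.X n}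
    (hx : x ∈ A.B r p n) : (φ.f n).hom x ∈ B.B r p n := by
  obtain ⟨a, ha, b, hb, rfl⟩ := (A.mem_B rfl).1 hx
  exact (B.mem_B rfl).2 ⟨_, hφ.map_Z ha, _, hφ.map_Z hb, by rw [hom_d, map_add]⟩

theorem IsFiltered.sub {φ ψ : A.C ⟶ B.C} (hφ : IsFiltered φ) (hψ : IsFiltered ψ) :
    IsFiltered (φ - ψ) := fun p n _ h => Submodule.sub_mem _ (hφ p n h) (hψ p n h)

/-- The map induced on `E^r_{p,q}` by a filtered morphism. -/
noncomputable def pageMapX (φ : A.C ⟶ B.C) (hφ : IsFiltered φ) (r : ℤ) (pq : ℤ × ℤ) :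
    A.E r pq →ₗ[K] B.E r pq :=
  Submodule.mapQ _ _ ((φ.f (pq.1 + pq.2)).hom.restrict fun _ hx => hφ.map_Z hx)
    fun _ hx => hφ.map_B hx

theorem pageMapX_cls (φ : A.C ⟶ B.C) (hφ : IsFiltered φ) (r : ℤ) (pq : ℤ × ℤ) (x hx) :
    pageMapX φ hφ r pq (A.cls r pq x hx) = B.cls r pq ((φ.f _).hom x) (hφ.map_Z hx) := rfl

/-- The morphism of `r`-th pages induced by a filtered morphism. -/
noncomputable def pageMap (φ : A.C ⟶ B.C) (hφ : IsFiltered φ) (r : ℤ) : A.page r ⟶ B.page r where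
  f pq := ModuleCat.ofHom (pageMapX φ hφ r pq)
  comm' pq pq' h := by
    refine ModuleCat.hom_ext (LinearMap.ext fun e => ?_)
    obtain ⟨x, hx, rfl⟩ := A.cls_surj e
    obtain ⟨h1, e1⟩ := A.pageD_cls h x hx
    obtain ⟨h2, e2⟩ := B.pageD_cls h _ (hφ.map_Z hx)
    change B.pageD r pq pq' (B.cls r pq ((φ.f _).hom x) (hφ.map_Z hx)) =
      pageMapX φ hφ r pq' (A.pageD r pq pq' _)
    rw [e1, e2, pageMapX_cls, B.cls_eq_cls, hom_d, sub_self]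
    exact Submodule.zero_mem _

/-- The class in `E^{r+1}` of `x ∈ Z^{r+1}` corresponds to the homology class of a cycle of the
`r`-th page, namely of the class of `x` in `E^r`. -/
theorem exists_pageIso_inv_cls (A : FilteredComplex.{v, w} K) (r : ℤ) (pq : ℤ × ℤ) (x)
    (hx : x ∈ A.Z (r + 1) pq.1 (pq.1 + pq.2)) :
    ∃ z : (A.page r).cycles pq,
      ((A.page r).iCycles pq).hom z = A.cls r pq x (A.Z_succ_le _ _ _ hx) ∧
      (A.pageIso r pq).inv.hom (A.cls (r + 1) pq x hx) = ((A.page r).homologyπ pq).hom z := by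
  have h₁ : pq - (-r, r - 1) + (-r, r - 1) = pq := sub_add_cancel _ _
  let S := (A.page r).sc' (pq - (-r, r - 1)) pq (pq + (-r, r - 1))
  let i := (A.page r).isoSc' (pq - (-r, r - 1)) pq (pq + (-r, r - 1))
      (ComplexShape.prev_eq' _ h₁) (ComplexShape.next_eq' _ rfl)
  let y : S.moduleCatLeftHomologyData.K :=
    ⟨A.cls r pq x (A.Z_succ_le _ _ _ hx), A.pageD_cls_succ r pq _ rfl x hx⟩
  refine ⟨(ShortComplex.cyclesMap i.inv).hom (S.moduleCatCyclesIso.inv.hom y), ?_, ?_⟩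
  · have h1 : ShortComplex.cyclesMap i.inv ≫ (A.page r).iCycles pq = S.iCycles ≫ i.inv.τ₂ :=
      ShortComplex.cyclesMap_i _
    have h2 := S.moduleCatCyclesIso_inv_iCycles
    have h3 := congrArg (fun f => f.hom (S.moduleCatCyclesIso.inv.hom y)) h1
    have h4 := congrArg (fun f => f.hom y) h2
    exact h3.trans (congrArg i.inv.τ₂.hom h4)
  · have h1 : S.homologyπ ≫ ShortComplex.homologyMap i.inv =
        ShortComplex.cyclesMap i.inv ≫ (A.page r).homologyπ pq :=
      ShortComplex.homologyπ_naturality _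
    have h2 := S.moduleCatCyclesIso_inv_π
    have h3 := congrArg (fun f => f.hom (S.moduleCatCyclesIso.inv.hom y)) h1
    have h4 := congrArg (fun f => f.hom y) h2
    exact Eq.trans (congrArg (ShortComplex.homologyMap i.inv).hom h4.symm) h3

theorem pageIso_inv_naturality (φ : A.C ⟶ B.C) (hφ : IsFiltered φ) (r : ℤ) (pq : ℤ × ℤ) :
    (A.pageIso r pq).inv ≫ HomologicalComplex.homologyMap (pageMap φ hφ r) pq =
      (pageMap φ hφ (r + 1)).f pq ≫ (B.pageIso r pq).inv := by
  refine ModuleCat.hom_ext (LinearMap.ext fun e => ?_)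
  obtain ⟨x, hx, rfl⟩ := A.cls_surj e
  obtain ⟨z, hz, h1⟩ := A.exists_pageIso_inv_cls r pq x hx
  obtain ⟨z', hz', h2⟩ := B.exists_pageIso_inv_cls r pq _ (hφ.map_Z hx)
  have h3 := congrArg (fun f => f.hom z)
    (HomologicalComplex.homologyπ_naturality (pageMap φ hφ r) pq)
  have h4 := congrArg (fun f => f.hom z) (HomologicalComplex.cyclesMap_i (pageMap φ hφ r) pq)
  have hzz : (HomologicalComplex.cyclesMap (pageMap φ hφ r) pq).hom z = z' := by
    refine (ModuleCat.mono_iff_injective ((B.page r).iCycles pq)).1 inferInstance ?_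
    refine Eq.trans h4 (Eq.trans ?_ hz'.symm)
    exact congrArg (pageMapX φ hφ r pq) hz
  change (HomologicalComplex.homologyMap (pageMap φ hφ r) pq).hom
    ((A.pageIso r pq).inv.hom (A.cls (r + 1) pq x hx)) =
      (B.pageIso r pq).inv.hom (B.cls (r + 1) pq _ (hφ.map_Z hx))
  rw [h1, h2, ← hzz]
  exact h3

/-- The morphism of spectral sequences induced by a filtered morphism. -/
noncomputable def spectralMap (φ : A.C ⟶ B.C) (hφ : IsFiltered φ) :
    A.spectralSequence ⟶ B.spectralSequence where
  hom r _ := pageMap φ hφ r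
  comm r r' pq h _ := by
    subst h
    have h1 := pageIso_inv_naturality φ hφ r pq
    rw [Iso.inv_comp_eq, ← Category.assoc, Iso.eq_comp_inv] at h1
    simpa [spectralSequence] using h1

/-- Mutually inverse filtered morphisms induce an isomorphism of spectral sequences. -/
noncomputable def spectralIso (φ : A.C ⟶ B.C) (hφ : IsFiltered φ) (ψ : B.C ⟶ A.C)
    (hψ : IsFiltered ψ) (h1 : φ ≫ ψ = 𝟙 _) (h2 : ψ ≫ φ = 𝟙 _) :
    A.spectralSequence ≅ B.spectralSequence where
  hom := spectralMap φ hφ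
  inv := spectralMap ψ hψ
  hom_inv_id := by
    ext r hr pq e
    obtain ⟨x, hx, rfl⟩ := A.cls_surj e
    change A.cls r pq (((φ ≫ ψ).f _).hom x) _ = A.cls r pq x hx
    congr 1
    rw [h1]; rfl
  inv_hom_id := by
    ext r hr pq e
    obtain ⟨x, hx, rfl⟩ := B.cls_surj e
    change B.cls r pq (((ψ ≫ φ).f _).hom x) _ = B.cls r pq x hx
    congr 1
    rw [h2]; rfl

theorem hom_sum_f_apply {ι : Type*} {X Y : HomologicalComplex (ModuleCat.{w} K) (.down ℤ)}
    (s : Finset ι) (f : ι → (X ⟶ Y)) (n : ℤ) (x : X.X n) :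
    ((∑ k ∈ s, f k).f n).hom x = ∑ k ∈ s, ((f k).f n).hom x := by
  classical
  induction s using Finset.induction_on with
  | empty => rfl
  | insert a s ha ih =>
    rw [Finset.sum_insert ha, Finset.sum_insert ha, ← ih]
    rfl

/-- A decomposition of a filtered complex as a finite direct sum of filtered complexes induces a
decomposition of its spectral sequence. -/
theorem isDirectSum_spectralMap {ι : Type*} [Fintype ι] (S : ι → FilteredComplex.{v, w} K)
    (i : ∀ k, (S k).C ⟶ A.C) (hi : ∀ k, IsFiltered (i k))
    (π : ∀ k, A.C ⟶ (S k).C) (hπ : ∀ k, IsFiltered (π k))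
    (h1 : ∀ k, i k ≫ π k = 𝟙 _) (h0 : ∀ k l, k ≠ l → i k ≫ π l = 0)
    (hsum : ∑ k, π k ≫ i k = 𝟙 A.C) :
    IsDirectSumOfSpectralSequences (fun k => (S k).spectralSequence) A.spectralSequence
      (fun k => spectralMap (i k) (hi k)) := by
  classical
  intro r hr pq
  have hπi : ∀ k l (e : (S k).E r pq),
      pageMapX (π l) (hπ l) r pq (pageMapX (i k) (hi k) r pq e) =
        if h : k = l then h ▸ e else 0 := by
    intro k l e
    obtain ⟨x, hx, rfl⟩ := (S k).cls_surj e
    rw [pageMapX_cls, pageMapX_cls]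
    split_ifs with h
    · subst h
      change (S k).cls r pq (((i k ≫ π k).f _).hom x) _ = _
      congr 1
      rw [h1]; rfl
    · rw [cls_eq_zero]
      change (((i k ≫ π l).f _).hom x) ∈ _
      rw [h0 k l h]
      exact Submodule.zero_mem _
  have key : ∀ (x : ∀ k, (S k).E r pq) l,
      pageMapX (π l) (hπ l) r pq (∑ k, pageMapX (i k) (hi k) r pq (x k)) = x l := by
    intro x l
    rw [map_sum, Finset.sum_eq_single l]
    · rw [hπi, dif_pos rfl]
    · intro k _ hkl
      rw [hπi, dif_neg hkl]
    · simp
  constructor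
  · intro x y hxy
    funext l
    have := congrArg (pageMapX (π l) (hπ l) r pq) hxy
    exact (key x l).symm.trans (this.trans (key y l))
  · intro e
    obtain ⟨x, hx, rfl⟩ := A.cls_surj e
    refine ⟨fun k => pageMapX (π k) (hπ k) r pq (A.cls r pq x hx), ?_⟩
    have h2 := congrArg (fun f : A.C ⟶ A.C => (f.f (pq.1 + pq.2)).hom x) hsum
    rw [hom_sum_f_apply] at h2
    have h3 : ∑ k, (⟨((π k ≫ i k).f (pq.1 + pq.2)).hom x,
        ((hπ k).comp (hi k)).map_Z hx⟩ : A.Z r pq.1 (pq.1 + pq.2)) = ⟨x, hx⟩ := by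
      apply Subtype.ext
      rw [AddSubmonoidClass.coe_finsetSum]
      exact h2
    exact (map_sum (Submodule.mkQ ((A.B r pq.1 (pq.1 + pq.2)).submoduleOf _)) _ _).symm.trans
      (congrArg (Submodule.mkQ _) h3)

/-- A complex mapping to the underlying complex of `A`, with the filtration induced by that
of `A`. -/
def pullback (A : FilteredComplex.{v, w} K) {Y : HomologicalComplex (ModuleCat.{w} K) _}
    (i : Y ⟶ A.C) : FilteredComplex.{v, w} K where
  C := Y
  F p n := (A.F p n).comap (i.f n).hom
  mono h n := Submodule.comap_mono (A.mono h n)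
  d_mem {p n} m x hx := by
    have h1 : (A.C.d n m).hom ((i.f n).hom x) = (i.f m).hom ((Y.d n m).hom x) := by
      rw [← LinearMap.comp_apply, ← ModuleCat.hom_comp, i.comm, ModuleCat.hom_comp,
        LinearMap.comp_apply]
    rw [Submodule.mem_comap, ← h1]
    exact A.d_mem m hx

/-- A filtered idempotent endomorphism `q` of a filtered complex splits: it is the projection onto
a filtered complex `S` included in `A` by `i`. -/
theorem exists_split (q : A.C ⟶ A.C) (hq : IsFiltered q) (hqq : q ≫ q = q) :
    ∃ (S : FilteredComplex.{v, w} K) (i : S.C ⟶ A.C) (π : A.C ⟶ S.C),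
      IsFiltered i ∧ IsFiltered π ∧ i ≫ π = 𝟙 _ ∧ π ≫ i = q := by
  obtain ⟨Y, i, π, h1, h2⟩ := IsIdempotentComplete.idempotents_split A.C q hqq
  refine ⟨A.pullback i, i, π, fun _ _ _ h => h, fun p n x hx => ?_, h1, h2⟩
  change ((π ≫ i).f n).hom x ∈ A.F p n
  rw [h2]
  exact hq p n hx

end FilteredComplex

/-! ### Lists of vertices and the reachability complex -/

namespace Digraph

open Quasimetric

variable {V W U : Type u} {G : Digraph V} {H : Digraph W} {L : Digraph U}
variable {K : Type v} [CommRing K]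

variable (G K) in
/-- The span, in the free module on all lists, of the lists of `n + 1` vertices of length at most
`l < ∞`, degenerate ones included. The constituents of these lists are mutually reachable. -/
noncomputable def freeFiltration (n : ℤ) (l : ℕ) : Submodule K (List V →₀ K) :=
  Submodule.span K {y | ∃ t : List V, (t.length : ℤ) = n + 1 ∧ G.tupleLength t ≤ l ∧
    y = Finsupp.single t 1}

theorem single_mem_freeFiltration {n : ℤ} {l : ℕ} {t : List V} (h : (t.length : ℤ) = n + 1)
    (h' : G.tupleLength t ≤ l) : Finsupp.single t 1 ∈ freeFiltration G K n l :=
  Submodule.subset_span ⟨t, h, h', rfl⟩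

theorem isChain_of_tupleLength_lt_top {t : List V} (h : G.tupleLength t < ⊤) :
    t.IsChain fun g g' => G.pathDist g g' < ⊤ := by
  induction t with
  | nil => exact .nil
  | cons x t ih =>
    cases t with
    | nil => exact .singleton _
    | cons y t =>
      rw [tupleLength_cons_cons] at h
      obtain ⟨h1, h2⟩ := WithTop.add_lt_top.1 h
      exact List.isChain_cons_cons.2 ⟨h1, ih h2⟩

theorem tupleLength_lt_top_of_isChain {t : List V}
    (h : t.IsChain fun g g' => G.pathDist g g' < ⊤) : G.tupleLength t < ⊤ := by
  induction t with
  | nil => simp [tupleLength]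
  | cons x t ih =>
    cases t with
    | nil => simp [tupleLength]
    | cons y t =>
      rw [tupleLength_cons_cons]
      exact WithTop.add_lt_top.2 ⟨(List.isChain_cons_cons.1 h).1, ih (List.isChain_cons_cons.1 h).2⟩

theorem exists_single_mem_freeFiltration {n : ℤ} (t : {t : List V // G.IsReachTuple n t}) :
    ∃ l, Finsupp.single t.1 1 ∈ freeFiltration G K n l := by
  have h := tupleLength_lt_top_of_isChain (t.2.2.2.imp fun _ _ h => h.2)
  obtain ⟨l, hl⟩ := ENat.ne_top_iff_exists.1 h.ne
  exact ⟨l, single_mem_freeFiltration t.2.2.1 hl.symm.le⟩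

theorem freeProj_single (n : ℤ) (t : List V) :
    freeProj G K n (Finsupp.single t 1) = G.tupleClass K n t := by
  simp [freeProj]

theorem freeProj_mem_rcFiltration {n : ℤ} {l : ℕ} {y : List V →₀ K}
    (hy : y ∈ freeFiltration G K n l) : freeProj G K n y ∈ G.rcFiltration K l n := by
  induction hy using Submodule.span_induction with
  | mem y hy =>
    obtain ⟨t, h1, h2, rfl⟩ := hy
    rw [freeProj_single, tupleClass]
    split_ifs with h
    · obtain ⟨k, hk⟩ := ENat.ne_top_iff_exists.1 (ne_top_of_le_ne_top (ENat.natCast_ne_top l) h2)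
      rw [← hk] at h2
      exact Submodule.subset_span ⟨⟨t, h⟩, ⟨k, hk.symm, by exact_mod_cast h2⟩, rfl⟩
    · exact Submodule.zero_mem _
  | zero => simp
  | add f g _ _ hf hg => rw [map_add]; exact Submodule.add_mem _ hf hg
  | smul c f _ hf => rw [map_smul]; exact Submodule.smul_mem _ c hf

theorem freeBd_mem_freeFiltration {n m : ℤ} (hnm : m + 1 = n) {l : ℕ} {y : List V →₀ K}
    (hy : y ∈ freeFiltration G K n l) : freeBd V K y ∈ freeFiltration G K m l := by
  induction hy using Submodule.span_induction with
  | mem y hy =>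
    obtain ⟨t, h1, h2, rfl⟩ := hy
    rw [freeBd, Finsupp.linearCombination_single, one_smul]
    refine Submodule.sum_mem _ fun i hi => Submodule.smul_mem _ _ (single_mem_freeFiltration ?_
      ((G.tupleLength_eraseIdx_le t i).trans h2))
    have h3 := List.length_eraseIdx_of_lt (Finset.mem_range.1 hi)
    have h4 := Finset.mem_range.1 hi
    omega
  | zero => simp
  | add f g _ _ hf hg => rw [map_add]; exact Submodule.add_mem _ hf hg
  | smul c f _ hf => rw [map_smul]; exact Submodule.smul_mem _ c hf

theorem rcD_freeProj (m k : ℤ) {l : ℕ} {y : List V →₀ K} (hy : y ∈ freeFiltration G K m l) :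
    G.rcD K m k (freeProj G K m y) = freeProj G K k (freeBd V K y) := by
  induction hy using Submodule.span_induction with
  | mem y hy =>
    obtain ⟨t, h1, h2, rfl⟩ := hy
    rw [freeProj_single]
    exact rcD_tupleClass m k h1
      (isChain_of_tupleLength_lt_top (h2.trans_lt (ENat.natCast_lt_top l)))
  | zero => simp
  | add f g _ _ hf hg => simp only [map_add, hf, hg]
  | smul c f _ hf => simp only [map_smul, hf]

/-! ### Operators on the reachability complex induced by operators on lists -/

variable (G H) in
/-- The map `RC_n(G) → RC_m(H)` induced by an operator between the free modules on all lists. -/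
noncomputable def rcLift (T : (List V →₀ K) →ₗ[K] (List W →₀ K)) (n m : ℤ) :
    G.RCMod K n →ₗ[K] H.RCMod K m :=
  Finsupp.linearCombination K fun t => freeProj H K m (T (Finsupp.single t.1 1))

theorem rcLift_single (T : (List V →₀ K) →ₗ[K] (List W →₀ K)) (n m : ℤ)
    (t : {t : List V // G.IsReachTuple n t}) :
    rcLift G H T n m (Finsupp.single t 1) = freeProj H K m (T (Finsupp.single t.1 1)) := by
  simp [rcLift]

/-- An operator that preserves degenerate lists commutes with the projections onto the reachability
complexes. -/
theorem rcLift_freeProj {T : (List V →₀ K) →ₗ[K] (List W →₀ K)}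
    (hT : ∀ y ∈ degen V K, T y ∈ degen W K) {n m : ℤ}
    (hnil : freeProj H K m (T (Finsupp.single [] 1)) = 0) {l : ℕ} {y : List V →₀ K}
    (hy : y ∈ freeFiltration G K n l) :
    rcLift G H T n m (freeProj G K n y) = freeProj H K m (T y) := by
  induction hy using Submodule.span_induction with
  | mem y hy =>
    obtain ⟨t, h1, h2, rfl⟩ := hy
    by_cases ht : G.IsReachTuple n t
    · rw [freeProj_single, tupleClass, dif_pos ht, rcLift_single]
    · rw [freeProj_single, tupleClass, dif_neg ht, map_zero]
      by_cases h0 : t = []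
      · subst h0; exact hnil.symm
      · have h := isChain_of_tupleLength_lt_top (h2.trans_lt (ENat.natCast_lt_top l))
        refine (freeProj_degen m (hT _ (Submodule.subset_span
          ⟨t, fun hc => ht ⟨h0, h1, ?_⟩, rfl⟩))).symm
        rw [List.isChain_iff_getElem] at hc h ⊢
        exact fun i hi => ⟨hc i hi, h i hi⟩
  | zero => simp
  | add f g _ _ hf hg => simp only [map_add, hf, hg]
  | smul c f _ hf => simp only [map_smul, hf]

/-- An operator that raises lengths by at most `r` induces maps that shift the filtration by
`r`. -/
theorem rcLift_mem_rcFiltration {T : (List V →₀ K) →ₗ[K] (List W →₀ K)} {n m : ℤ} {r : ℕ}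
    (hT : ∀ l y, y ∈ freeFiltration G K n l → T y ∈ freeFiltration H K m (l + r)) {p : ℤ}
    {x : G.RCMod K n} (hx : x ∈ G.rcFiltration K p n) :
    rcLift G H T n m x ∈ H.rcFiltration K (p + r) m := by
  induction hx using Submodule.span_induction with
  | mem x hx =>
    obtain ⟨t, ⟨k, hk, hkl⟩, rfl⟩ := hx
    rw [rcLift_single]
    have h1 := freeProj_mem_rcFiltration (hT k _ (single_mem_freeFiltration t.2.2.1 hk.le))
    exact (H.reachabilityComplex K).mono (by push_cast; omega) m h1
  | zero => simp
  | add f g _ _ hf hg => rw [map_add]; exact Submodule.add_mem _ hf hg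
  | smul c f _ hf => rw [map_smul]; exact Submodule.smul_mem _ c hf

theorem rcMod_hom_ext {n : ℤ} {M : Type*} [AddCommGroup M] [Module K M]
    {f g : G.RCMod K n →ₗ[K] M} (h : ∀ t, f (Finsupp.single t 1) = g (Finsupp.single t 1)) :
    f = g :=
  Finsupp.lhom_ext' fun t => LinearMap.ext_ring (h t)

theorem free_hom_ext {M : Type*} [AddCommGroup M] [Module K M]
    {f g : (List V →₀ K) →ₗ[K] M} (h : ∀ t, f (Finsupp.single t 1) = g (Finsupp.single t 1)) :
    f = g :=
  Finsupp.lhom_ext' fun t => LinearMap.ext_ring (h t)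

/-! ### Functoriality of the reachability complex -/

variable (K) in
/-- The map on lists induced by a map of vertices. -/
noncomputable def freeMap (f : V → W) : (List V →₀ K) →ₗ[K] (List W →₀ K) :=
  Finsupp.lmapDomain K K (List.map f)

theorem freeMap_single (f : V → W) (t : List V) :
    freeMap K f (Finsupp.single t 1) = Finsupp.single (t.map f) 1 := by
  simp [freeMap]

theorem consMap_single (x : V) (t : List V) :
    consMap K x (Finsupp.single t 1) = Finsupp.single (x :: t) 1 := by
  simp [consMap]

theorem freeMap_consMap (f : V → W) (x : V) (y : List V →₀ K) :
    freeMap K f (consMap K x y) = consMap K (f x) (freeMap K f y) := by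
  have : (freeMap K f).comp (consMap K x) = (consMap K (f x)).comp (freeMap K f) :=
    free_hom_ext fun t => by
      simp only [LinearMap.comp_apply, consMap_single, freeMap_single, List.map_cons]
  exact LinearMap.congr_fun this y

theorem freeBd_freeMap (f : V → W) (y : List V →₀ K) :
    freeBd W K (freeMap K f y) = freeMap K f (freeBd V K y) := by
  have : (freeBd W K).comp (freeMap K f) = (freeMap K f).comp (freeBd V K) := by
    refine free_hom_ext fun t => ?_
    simp only [LinearMap.comp_apply]
    induction t with
    | nil => rw [freeMap_single, freeBd_nil, map_zero, List.map_nil, freeBd_nil]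
    | cons x t ih =>
      rw [← consMap_single, freeMap_consMap, freeBd_cons, freeBd_cons, map_sub, ih,
        freeMap_consMap]
  exact LinearMap.congr_fun this y

theorem freeMap_degen (f : V → W) (y : List V →₀ K) (hy : y ∈ degen V K) :
    freeMap K f y ∈ degen W K := by
  induction hy using Submodule.span_induction with
  | mem y hy =>
    obtain ⟨t, ht, rfl⟩ := hy
    rw [freeMap_single]
    refine Submodule.subset_span ⟨_, fun h => ht ?_, rfl⟩
    exact ((List.isChain_map f).1 h).imp fun a b hab => fun e => hab (congrArg f e)
  | zero => simp
  | add f g _ _ hf hg => rw [map_add]; exact Submodule.add_mem _ hf hg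
  | smul c f _ hf => rw [map_smul]; exact Submodule.smul_mem _ c hf

theorem freeProj_freeMap_nil (f : V → W) (m : ℤ) :
    freeProj H K m (freeMap K f (Finsupp.single [] 1)) = 0 := by
  rw [freeMap_single, freeProj_single]
  exact dif_neg fun h => h.1 rfl

theorem pathDist_map_le (φ : ShortMap G.toQuasimetric H.toQuasimetric) (x y : V) :
    H.pathDist (φ.1 x) (φ.1 y) ≤ G.pathDist x y :=
  ENat.toENNReal_le.1 (φ.2 x y)

theorem tupleLength_map_le (φ : ShortMap G.toQuasimetric H.toQuasimetric) (t : List V) :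
    H.tupleLength (t.map φ.1) ≤ G.tupleLength t := by
  induction t with
  | nil => simp [tupleLength]
  | cons x t ih =>
    cases t with
    | nil => simp [tupleLength]
    | cons y t =>
      rw [List.map_cons, List.map_cons, tupleLength_cons_cons, tupleLength_cons_cons]
      exact add_le_add (pathDist_map_le φ x y) ih

theorem freeMap_mem_freeFiltration (φ : ShortMap G.toQuasimetric H.toQuasimetric) {n : ℤ} {l : ℕ}
    {y : List V →₀ K} (hy : y ∈ freeFiltration G K n l) :
    freeMap K φ.1 y ∈ freeFiltration H K n l := by
  induction hy using Submodule.span_induction with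
  | mem y hy =>
    obtain ⟨t, h1, h2, rfl⟩ := hy
    rw [freeMap_single]
    exact single_mem_freeFiltration (by rwa [List.length_map]) ((tupleLength_map_le φ t).trans h2)
  | zero => simp
  | add f g _ _ hf hg => rw [map_add]; exact Submodule.add_mem _ hf hg
  | smul c f _ hf => rw [map_smul]; exact Submodule.smul_mem _ c hf

variable (K) in
/-- The chain map induced by a short map. -/
noncomputable def rcMap (φ : ShortMap G.toQuasimetric H.toQuasimetric) :
    (G.reachabilityComplex K).C ⟶ (H.reachabilityComplex K).C where
  f n := ModuleCat.ofHom (rcLift G H (freeMap K φ.1) n n)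
  comm' n m hnm := by
    refine ModuleCat.hom_ext (rcMod_hom_ext fun t => ?_)
    obtain ⟨l, hl⟩ := exists_single_mem_freeFiltration (K := K) t
    change H.rcD K n m (rcLift G H _ n n (Finsupp.single t 1)) =
      rcLift G H _ m m (G.rcD K n m (Finsupp.single t 1))
    rw [rcLift_single, rcD_freeProj n m (freeMap_mem_freeFiltration φ hl), rcD_single',
      rcLift_freeProj (freeMap_degen φ.1) (freeProj_freeMap_nil φ.1 m)
        (freeBd_mem_freeFiltration hnm hl), freeBd_freeMap]

theorem rcMap_isFiltered (φ : ShortMap G.toQuasimetric H.toQuasimetric) :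
    FilteredComplex.IsFiltered (rcMap K φ) := by
  intro p n x hx
  have := rcLift_mem_rcFiltration (r := 0) (T := freeMap K φ.1) (m := n)
    (fun l y hy => freeMap_mem_freeFiltration φ hy) hx
  rwa [Nat.cast_zero, add_zero] at this

theorem rcMap_id : rcMap K G.toQuasimetric.idMap = 𝟙 _ := by
  refine HomologicalComplex.hom_ext _ _ fun n => ModuleCat.hom_ext (rcMod_hom_ext fun t => ?_)
  change rcLift G G _ n n (Finsupp.single t 1) = Finsupp.single t 1
  rw [rcLift_single, freeMap_single, freeProj_single, show t.1.map G.toQuasimetric.idMap.1 = t.1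
    from List.map_id _, tupleClass, dif_pos t.2]

theorem rcMap_comp (ψ : ShortMap H.toQuasimetric L.toQuasimetric)
    (φ : ShortMap G.toQuasimetric H.toQuasimetric) :
    rcMap K (ψ.comp φ) = rcMap K φ ≫ rcMap K ψ := by
  refine HomologicalComplex.hom_ext _ _ fun n => ModuleCat.hom_ext (rcMod_hom_ext fun t => ?_)
  obtain ⟨l, hl⟩ := exists_single_mem_freeFiltration (K := K) t
  change rcLift G L _ n n (Finsupp.single t 1) =
    rcLift H L _ n n (rcLift G H _ n n (Finsupp.single t 1))
  rw [rcLift_single, rcLift_single, rcLift_freeProj (freeMap_degen ψ.1)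
    (freeProj_freeMap_nil ψ.1 n) (freeMap_mem_freeFiltration φ hl), freeMap_single,
    freeMap_single, freeMap_single, List.map_map]
  rfl

/-! ### Homotopy invariance of the pages -/

variable (K) in
/-- The prism operator
`(g_0, …, g_n) ↦ ∑ i, (-1)^i (f g_0, …, f g_i, g g_i, …, g g_n)` on a list. -/
noncomputable def prismList (f g : V → W) : List V → (List W →₀ K)
  | [] => 0
  | x :: t => Finsupp.single (f x :: g x :: t.map g) 1 - consMap K (f x) (prismList f g t)

variable (K) in
/-- The linear extension of the prism operator. -/
noncomputable def prism (f g : V → W) : (List V →₀ K) →ₗ[K] (List W →₀ K) :=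
  Finsupp.linearCombination K (prismList K f g)

theorem prism_nil (f g : V → W) : prism K f g (Finsupp.single [] 1) = 0 := by
  simp [prism, prismList]

theorem prism_consMap (f g : V → W) (x : V) (y : List V →₀ K) :
    prism K f g (consMap K x y) =
      consMap K (f x) (consMap K (g x) (freeMap K g y)) - consMap K (f x) (prism K f g y) := by
  have : (prism K f g).comp (consMap K x) =
      (consMap K (f x)).comp ((consMap K (g x)).comp (freeMap K g)) -
        (consMap K (f x)).comp (prism K f g) := free_hom_ext fun t => by
    simp only [LinearMap.comp_apply, LinearMap.sub_apply, consMap_single, freeMap_single, prism,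
      Finsupp.linearCombination_single, one_smul, prismList]
  exact LinearMap.congr_fun this y

/-- The prism operator is a chain homotopy. -/
theorem freeBd_prism (f g : V → W) (y : List V →₀ K) :
    freeBd W K (prism K f g y) =
      freeMap K g y - freeMap K f y - prism K f g (freeBd V K y) := by
  have : (freeBd W K).comp (prism K f g) =
      freeMap K g - freeMap K f - (prism K f g).comp (freeBd V K) := by
    refine free_hom_ext fun t => ?_
    simp only [LinearMap.comp_apply, LinearMap.sub_apply]
    induction t with
    | nil => simp [prism_nil, freeBd_nil, freeMap_single]
    | cons x t ih =>
      rw [← consMap_single, prism_consMap]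
      simp only [map_sub, freeBd_cons, ih, freeMap_consMap, freeBd_freeMap, prism_consMap]
      abel
  exact LinearMap.congr_fun this y

theorem prism_degen (f g : V → W) (y : List V →₀ K) (hy : y ∈ degen V K) :
    prism K f g y ∈ degen W K := by
  have h : ∀ t : List V, ¬ t.IsChain (· ≠ ·) → prism K f g (Finsupp.single t 1) ∈ degen W K := by
    intro t
    induction t with
    | nil => simp
    | cons x t ih =>
      intro ht
      by_cases h : t.IsChain (· ≠ ·)
      · cases t with
        | nil => simp at ht
        | cons z t =>
          have hxz : x = z := by
            by_contra hne
            exact ht (List.isChain_cons_cons.2 ⟨hne, h⟩)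
          subst hxz
          rw [← consMap_single, ← consMap_single, prism_consMap, prism_consMap, map_sub,
            freeMap_consMap]
          exact Submodule.sub_mem _ (consMap_degen _ (consMap_consMap_degen _ _))
            (Submodule.sub_mem _ (consMap_consMap_degen _ _) (consMap_consMap_degen _ _))
      · rw [← consMap_single, prism_consMap]
        refine Submodule.sub_mem _ (consMap_degen _ (consMap_degen _ (freeMap_degen g _ ?_)))
          (consMap_degen _ (ih h))
        exact Submodule.subset_span ⟨t, h, rfl⟩
  induction hy using Submodule.span_induction with
  | mem y hy => obtain ⟨t, ht, rfl⟩ := hy; exact h t ht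
  | zero => simp
  | add f g _ _ hf hg => rw [map_add]; exact Submodule.add_mem _ hf hg
  | smul c f _ hf => rw [map_smul]; exact Submodule.smul_mem _ c hf

/-- The terms of the prism on a list start with the image of its head; they are one entry longer,
and their length exceeds the given one by at most the distance of the two maps. -/
theorem prismList_mem (φ ψ : ShortMap G.toQuasimetric H.toQuasimetric) {r : ℕ}
    (hr : ∀ x, H.pathDist (φ.1 x) (ψ.1 x) ≤ r) (x : V) (t : List V) :
    prismList K φ.1 ψ.1 (x :: t) ∈ Submodule.span K {y | ∃ s : List W,
      s.length = t.length + 1 ∧ H.tupleLength (φ.1 x :: s) ≤ G.tupleLength (x :: t) + r ∧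
        y = Finsupp.single (φ.1 x :: s) 1} := by
  induction t generalizing x with
  | nil =>
    rw [prismList, prismList, map_zero, sub_zero]
    refine Submodule.subset_span ⟨_, by simp, ?_, rfl⟩
    simpa [tupleLength] using hr x
  | cons z t ih =>
    rw [prismList]
    refine Submodule.sub_mem _ (Submodule.subset_span ⟨_, by simp, ?_, rfl⟩) ?_
    · rw [tupleLength_cons_cons, add_comm]
      exact add_le_add (tupleLength_map_le ψ (x :: z :: t)) (hr x)
    · have hy := ih z
      generalize prismList K φ.1 ψ.1 (z :: t) = y at hy ⊢
      induction hy using Submodule.span_induction with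
      | mem y hy =>
        obtain ⟨s, h1, h2, rfl⟩ := hy
        rw [consMap_single]
        refine Submodule.subset_span ⟨_, by simp [h1], ?_, rfl⟩
        rw [tupleLength_cons_cons, tupleLength_cons_cons, add_assoc]
        exact add_le_add (pathDist_map_le φ x z) h2
      | zero => simp
      | add f g _ _ hf hg => rw [map_add]; exact Submodule.add_mem _ hf hg
      | smul c f _ hf => rw [map_smul]; exact Submodule.smul_mem _ c hf

theorem prism_mem_freeFiltration (φ ψ : ShortMap G.toQuasimetric H.toQuasimetric) {r : ℕ}
    (hr : ∀ x, H.pathDist (φ.1 x) (ψ.1 x) ≤ r) {n m : ℤ} (hnm : n + 1 = m) {l : ℕ}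
    {y : List V →₀ K} (hy : y ∈ freeFiltration G K n l) :
    prism K φ.1 ψ.1 y ∈ freeFiltration H K m (l + r) := by
  induction hy using Submodule.span_induction with
  | mem y hy =>
    obtain ⟨t, h1, h2, rfl⟩ := hy
    cases t with
    | nil => rw [prism_nil]; exact Submodule.zero_mem _
    | cons x t =>
      rw [prism, Finsupp.linearCombination_single, one_smul]
      refine Submodule.span_mono ?_ (prismList_mem φ ψ hr x t)
      rintro _ ⟨s, h3, h4, rfl⟩
      rw [List.length_cons] at h1
      refine ⟨_, ?_, h4.trans ?_, rfl⟩
      · rw [List.length_cons, h3]; push_cast at h1 ⊢; omega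
      · push_cast
        gcongr
  | zero => simp
  | add f g _ _ hf hg => rw [map_add]; exact Submodule.add_mem _ hf hg
  | smul c f _ hf => rw [map_smul]; exact Submodule.smul_mem _ c hf

/-- The chain homotopy on reachability complexes induced by the prism operator. -/
theorem rcD_rcLift_prism (φ ψ : ShortMap G.toQuasimetric H.toQuasimetric) {r : ℕ}
    (hr : ∀ x, H.pathDist (φ.1 x) (ψ.1 x) ≤ r) {n m k : ℤ} (hnm : n + 1 = m) (hkn : k + 1 = n)
    (x : G.RCMod K n) :
    H.rcD K m n (rcLift G H (prism K φ.1 ψ.1) n m x) =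
      rcLift G H (freeMap K ψ.1) n n x - rcLift G H (freeMap K φ.1) n n x -
        rcLift G H (prism K φ.1 ψ.1) k n (G.rcD K n k x) := by
  have : (H.rcD K m n).comp (rcLift G H (prism K φ.1 ψ.1) n m) =
      rcLift G H (freeMap K ψ.1) n n - rcLift G H (freeMap K φ.1) n n -
        (rcLift G H (prism K φ.1 ψ.1) k n).comp (G.rcD K n k) := by
    refine rcMod_hom_ext fun t => ?_
    obtain ⟨l, hl⟩ := exists_single_mem_freeFiltration (K := K) t
    simp only [LinearMap.comp_apply, LinearMap.sub_apply, rcLift_single]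
    rw [rcD_freeProj m n (prism_mem_freeFiltration φ ψ hr hnm hl), freeBd_prism, rcD_single',
      rcLift_freeProj (prism_degen φ.1 ψ.1) (by rw [prism_nil, map_zero])
        (freeBd_mem_freeFiltration hkn hl), map_sub, map_sub]
  exact LinearMap.congr_fun this x

/-- If `φ` and `ψ` are at distance at most `r`, the chain homotopy raises the filtration by at most
`r`, so the two maps agree on `E^{r+1}`. -/
theorem sub_mem_B_of_pathDist_le (φ ψ : ShortMap G.toQuasimetric H.toQuasimetric) {r : ℕ}
    (hr : ∀ x, H.pathDist (φ.1 x) (ψ.1 x) ≤ r) {p n : ℤ} {x : G.RCMod K n}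
    (hx : x ∈ (G.reachabilityComplex K).Z (r + 1) p n) :
    ((rcMap K ψ).f n).hom x - ((rcMap K φ).f n).hom x ∈
      (H.reachabilityComplex K).B (r + 1) p n := by
  let h (n m : ℤ) := rcLift G H (prism K φ.1 ψ.1) n m
  have hh : ∀ {n m p : ℤ}, n + 1 = m → ∀ {y : G.RCMod K n}, y ∈ G.rcFiltration K p n →
      h n m y ∈ H.rcFiltration K (p + r) m := fun hnm _ hy =>
    rcLift_mem_rcFiltration (fun l z hz => prism_mem_freeFiltration φ ψ hr hnm hz) hy
  have hφψ : ∀ {n p : ℤ} {y : G.RCMod K n}, y ∈ G.rcFiltration K p n →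
      rcLift G H (freeMap K ψ.1) n n y - rcLift G H (freeMap K φ.1) n n y ∈
        H.rcFiltration K p n := fun hy =>
    Submodule.sub_mem _ (rcMap_isFiltered ψ _ _ hy) (rcMap_isFiltered φ _ _ hy)
  have hdx : G.rcD K n (n - 1) x ∈ G.rcFiltration K (p - (r + 1)) (n - 1) := hx.2
  have hhdx := hh (by omega : n - 1 + 1 = n) hdx
  rw [show p - (r + 1) + r = p - 1 by ring] at hhdx
  have key := rcD_rcLift_prism φ ψ hr rfl (by omega : n - 1 + 1 = n) x
  refine (FilteredComplex.mem_B _ rfl).2 ⟨h (n - 1) n (G.rcD K n (n - 1) x), ?_,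
    h n (n + 1) x, ?_, ?_⟩
  · refine (FilteredComplex.mem_Z _ (by omega : n - 1 + 1 = n)).2 ⟨hhdx, ?_⟩
    have key' := rcD_rcLift_prism φ ψ hr (by omega : n - 1 + 1 = n)
      (by omega : n - 2 + 1 = n - 1) (G.rcD K n (n - 1) x)
    rw [rcD_rcD n (n - 1) (n - 2) (by omega), map_zero, sub_zero] at key'
    change H.rcD K n (n - 1) _ ∈ H.rcFiltration K _ _
    rw [key', show p - 1 - ((r : ℤ) + 1 - 1) = p - (r + 1) by ring]
    exact hφψ hdx
  · refine (FilteredComplex.mem_Z _ rfl).2 ⟨?_, ?_⟩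
    · rw [show p + ((r : ℤ) + 1) - 1 = p + r by ring]
      exact hh rfl hx.1
    · change H.rcD K (n + 1) n _ ∈ H.rcFiltration K _ _
      rw [key, show p + ((r : ℤ) + 1) - 1 - (r + 1 - 1) = p by ring]
      exact Submodule.sub_mem _ (hφψ hx.1)
        (H.reachabilityComplex K |>.mono (by omega : p - 1 ≤ p) n hhdx)
  · change _ + H.rcD K (n + 1) n _ = _
    rw [key]
    exact add_sub_cancel _ _

/-- `r`-homotopic short maps agree on the page `E^{r+1}`. -/
theorem sub_mem_B_of_homotopic {φ ψ : ShortMap G.toQuasimetric H.toQuasimetric} {r : ℕ}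
    (h : Homotopic (r : ℝ≥0) φ ψ) {p n : ℤ} {x : G.RCMod K n}
    (hx : x ∈ (G.reachabilityComplex K).Z (r + 1) p n) :
    ((rcMap K ψ).f n).hom x - ((rcMap K φ).f n).hom x ∈
      (H.reachabilityComplex K).B (r + 1) p n := by
  induction h with
  | refl => rw [sub_self]; exact Submodule.zero_mem _
  | @tail χ ω _ h ih =>
    have h1 : ((rcMap K ω).f n).hom x - ((rcMap K χ).f n).hom x ∈
        (H.reachabilityComplex K).B (r + 1) p n := by
      simp only [onShortMaps_le_iff, Nat.floor_natCast] at h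
      rcases h with h | h
      · exact sub_mem_B_of_pathDist_le χ ω h hx
      · rw [← neg_sub]
        exact Submodule.neg_mem _ (sub_mem_B_of_pathDist_le ω χ h hx)
    rw [← sub_add_sub_cancel]
    exact Submodule.add_mem _ h1 ih

end Digraph

/-! ### Differences of a decreasing sequence of idempotents -/

section IdempotentDifferences

variable {R : Type*} [Ring R]

/-- The jumps of a sequence `P` at the elements of a finite set `J`, in increasing order, and
as the last one the value of the sequence beyond all elements of `J`. -/
def idempotentJump (P : ℕ → R) (J : Finset ℕ) : WithTop (Fin J.card) → R
  | ⊤ => P (J.sup Nat.succ)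
  | (k : Fin J.card) => P (J.orderEmbOfFin rfl k) - P (J.orderEmbOfFin rfl k + 1)

variable {P : ℕ → R} {J : Finset ℕ}

theorem idempotentJump_top : idempotentJump P J ⊤ = P (J.sup Nat.succ) := rfl

theorem idempotentJump_coe (k : Fin J.card) :
    idempotentJump P J k = P (J.orderEmbOfFin rfl k) - P (J.orderEmbOfFin rfl k + 1) := rfl

theorem orderEmbOfFin_succ_le_sup (k : Fin J.card) :
    J.orderEmbOfFin rfl k + 1 ≤ J.sup Nat.succ :=
  Finset.le_sup (f := Nat.succ) (J.orderEmbOfFin_mem rfl k)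

/-- The jumps beyond `N` are fixed by `P N`. -/
theorem mul_idempotentJump (hP : ∀ i j, P i * P j = P (max i j)) {N : ℕ}
    (hN : N ≤ J.sup Nat.succ) (k : WithTop (Fin J.card))
    (hk : ∀ l : Fin J.card, k = l → N ≤ J.orderEmbOfFin rfl l) :
    P N * idempotentJump P J k = idempotentJump P J k := by
  induction k using WithTop.recTopCoe with
  | top => rw [idempotentJump_top, hP, max_eq_right hN]
  | coe l =>
    have := hk l rfl
    rw [idempotentJump_coe, mul_sub, hP, hP, max_eq_right this, max_eq_right (by omega)]

/-- Distinct jumps are orthogonal. -/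
theorem idempotentJump_mul_of_lt (hP : ∀ i j, P i * P j = P (max i j))
    {k l : WithTop (Fin J.card)} (h : k < l) :
    idempotentJump P J k * idempotentJump P J l = 0 ∧
    idempotentJump P J l * idempotentJump P J k = 0 := by
  induction k using WithTop.recTopCoe with
  | top => exact absurd h not_top_lt
  | coe k =>
    have h1 := orderEmbOfFin_succ_le_sup k
    induction l using WithTop.recTopCoe with
    | top =>
      rw [idempotentJump_top, idempotentJump_coe, mul_sub, sub_mul]
      simp only [hP]
      rw [max_eq_right h1, max_eq_left h1, max_eq_right (by omega), max_eq_left (by omega),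
        sub_self]
      exact ⟨rfl, rfl⟩
    | coe l =>
      have h2 : J.orderEmbOfFin rfl k < J.orderEmbOfFin rfl l :=
        (J.orderEmbOfFin rfl).lt_iff_lt.2 (WithTop.coe_lt_coe.1 h)
      simp only [idempotentJump_coe, mul_sub, sub_mul, hP]
      rw [max_eq_right (by omega), max_eq_right (by omega), max_eq_right (by omega),
        max_eq_right (by omega), max_eq_left (by omega), max_eq_left (by omega),
        max_eq_left (by omega), max_eq_left (by omega)]
      constructor <;> abel

theorem idempotentJump_mul_self (hP : ∀ i j, P i * P j = P (max i j))
    (k : WithTop (Fin J.card)) :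
    idempotentJump P J k * idempotentJump P J k = idempotentJump P J k := by
  induction k using WithTop.recTopCoe with
  | top => rw [idempotentJump_top, hP, max_self]
  | coe k =>
    simp only [idempotentJump_coe, mul_sub, sub_mul, hP, max_self]
    rw [max_eq_right (Nat.le_succ _), max_eq_left (Nat.le_succ _)]
    abel

/-- If the sequence is constant off `J`, then the jumps beyond `N` add up to its value at `N`. -/
theorem sum_idempotentJump (hJ : ∀ i ∉ J, P (i + 1) = P i) {N : ℕ} (hN : N ≤ J.sup Nat.succ)
    (p : WithTop (Fin J.card) → Prop) [DecidablePred p] (htop : p ⊤)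
    (hp : ∀ k : Fin J.card, p k ↔ N ≤ J.orderEmbOfFin rfl k) :
    ∑ k with p k, idempotentJump P J k = P N := by
  have h1 : ∑ k with p k, idempotentJump P J k = P (J.sup Nat.succ) +
      ∑ k : Fin J.card, if N ≤ J.orderEmbOfFin rfl k then
        P (J.orderEmbOfFin rfl k) - P (J.orderEmbOfFin rfl k + 1) else 0 := by
    have hsum : ∀ F : WithTop (Fin J.card) → R, ∑ k, F k = F ⊤ + ∑ k : Fin J.card, F k :=
      fun F => Fintype.sum_option F
    rw [Finset.sum_filter, hsum, if_pos htop]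
    refine congrArg _ ?_
    exact Finset.sum_congr rfl fun k _ => if_congr (hp k) rfl rfl
  have h2 : (∑ k : Fin J.card, if N ≤ J.orderEmbOfFin rfl k then
        P (J.orderEmbOfFin rfl k) - P (J.orderEmbOfFin rfl k + 1) else 0) =
      ∑ i ∈ J, if N ≤ i then P i - P (i + 1) else 0 := by
    conv_rhs => rw [← Finset.map_orderEmbOfFin_univ J rfl, Finset.sum_map]
    rfl
  have h3 : ∑ i ∈ J with N ≤ i, (P i - P (i + 1)) =
      ∑ i ∈ Finset.Ico N (J.sup Nat.succ), (P i - P (i + 1)) := by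
    refine Finset.sum_subset (fun i hi => ?_) fun i hi hi' => ?_
    · rw [Finset.mem_filter] at hi
      exact Finset.mem_Ico.2 ⟨hi.2, Finset.le_sup (f := Nat.succ) hi.1⟩
    · rw [Finset.mem_filter, not_and] at hi'
      rw [hJ i fun h => hi' h (Finset.mem_Ico.1 hi).1, sub_self]
  have h4 := Finset.sum_Ico_sub P hN
  rw [h1, h2, ← Finset.sum_filter, h3, ← neg_inj, neg_add, ← Finset.sum_neg_distrib]
  simp only [neg_sub, h4]
  abel

end IdempotentDifferences

/-! ### The idempotents of the reachability complex and the decomposition -/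

namespace Digraph

open Quasimetric

variable {V : Type u} [Finite V] (G : Digraph V) (K : Type v) [CommRing K]

/-- The idempotent endomorphism of the reachability complex induced by the `r`-th idempotent of the
system of minimal idempotents. -/
noncomputable def rcIdem (r : ℕ) : End (G.reachabilityComplex K).C :=
  rcMap K (G.toQuasimetric.minIdem r).1

theorem rcIdem_zero : G.rcIdem K 0 = 1 := by
  rw [rcIdem, minIdem_zero]
  exact rcMap_id

theorem rcIdem_mul (i j : ℕ) : G.rcIdem K i * G.rcIdem K j = G.rcIdem K (max i j) := by
  rw [End.mul_def, rcIdem, rcIdem, ← rcMap_comp, ← ShortMap.mul_eq_comp, rcIdem]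
  rcases le_total i j with h | h
  · rw [max_eq_right h, (G.toQuasimetric.minIdem_mul h).1]
  · rw [max_eq_left h, (G.toQuasimetric.minIdem_mul h).2]

/-- The integers `i` such that the cardinality of the minimal model drops from `i` to `i + 1`. -/
noncomputable def jumpSet : Finset ℕ := G.toQuasimetric.finite_modelCard_lt.toFinset

theorem mem_jumpSet {i : ℕ} :
    i ∈ G.jumpSet ↔ G.toQuasimetric.modelCard (i + 1) < G.toQuasimetric.modelCard i := by
  rw [jumpSet, Set.Finite.mem_toFinset]
  rfl

theorem rcIdem_succ {i : ℕ} (h : i ∉ G.jumpSet) : G.rcIdem K (i + 1) = G.rcIdem K i := by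
  rw [mem_jumpSet, not_lt] at h
  rw [rcIdem, minIdem_succ_eq _ h, rcIdem]

theorem jumpingPoints_eq : G.toQuasimetric.jumpingPoints =
    Set.range fun k : Fin G.jumpSet.card => ((G.jumpSet.orderEmbOfFin rfl k + 1 : ℕ) : ℝ≥0) := by
  ext r
  rw [mem_jumpingPoints_iff]
  constructor
  · rintro ⟨n, hn, rfl⟩
    obtain ⟨k, rfl⟩ : n ∈ Set.range (G.jumpSet.orderEmbOfFin rfl) := by
      rw [Finset.range_orderEmbOfFin]
      exact G.mem_jumpSet.2 hn
    exact ⟨k, rfl⟩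
  · rintro ⟨k, rfl⟩
    exact ⟨_, G.mem_jumpSet.1 (G.jumpSet.orderEmbOfFin_mem rfl k), rfl⟩

/-- The stable model is isometric to the image of the last idempotent. -/
theorem exists_splitting_stableModel :
    ∃ (α : ShortMap G.toQuasimetric G.stableModel.toQuasimetric)
      (β : ShortMap G.stableModel.toQuasimetric G.toQuasimetric),
      α.comp β = 1 ∧ β.comp α = (G.toQuasimetric.minIdem (G.jumpSet.sup Nat.succ)).1 := by
  have key : ∀ A : Set V, (∃ r : ℝ≥0, A = G.toQuasimetric.minimalModel r ∧
      ⌊r⌋₊ = G.jumpSet.sup Nat.succ) →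
      ∃ (α : ShortMap G.toQuasimetric (G.inducedOn A).toQuasimetric)
      (β : ShortMap (G.inducedOn A).toQuasimetric G.toQuasimetric),
      α.comp β = 1 ∧ β.comp α = (G.toQuasimetric.minIdem (G.jumpSet.sup Nat.succ)).1 := by
    rintro _ ⟨r, rfl, hr⟩
    rw [← hr]
    exact G.exists_splitting (G.minimalModel_isMinimalModel r)
  refine key _ ?_
  rw [Quasimetric.stableModel]
  have hsup : ∀ i ∈ G.jumpSet, i + 1 ≤ G.jumpSet.sup Nat.succ := fun i hi =>
    Finset.le_sup (f := Nat.succ) hi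
  split_ifs with h
  · refine ⟨_, rfl, ?_⟩
    have hJ : G.jumpSet.Nonempty := by
      obtain ⟨r, hr⟩ := h
      obtain ⟨n, hn, -⟩ := (G.mem_jumpingPoints_iff r).1 hr
      exact ⟨n, G.mem_jumpSet.2 hn⟩
    have : IsGreatest G.toQuasimetric.jumpingPoints ((G.jumpSet.sup Nat.succ : ℕ) : ℝ≥0) := by
      constructor
      · obtain ⟨i, hi, h'⟩ := Finset.exists_mem_eq_sup _ hJ Nat.succ
        exact (G.mem_jumpingPoints_iff _).2 ⟨i, G.mem_jumpSet.1 hi, by rw [h']⟩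
      · intro r hr
        obtain ⟨n, hn, rfl⟩ := (G.mem_jumpingPoints_iff r).1 hr
        exact_mod_cast hsup n (G.mem_jumpSet.2 hn)
    rw [this.csSup_eq, Nat.floor_natCast]
  · have hJ : G.jumpSet = ∅ := by
      refine Finset.eq_empty_of_forall_notMem fun i hi => h ?_
      exact ⟨_, (G.mem_jumpingPoints_iff _).2 ⟨i, G.mem_jumpSet.1 hi, rfl⟩⟩
    refine ⟨0, ?_, by rw [hJ]; simp⟩
    -- A `0`-homotopy is constant, so that the `0`-minimal model is the whole space.
    obtain ⟨ρ, -, hρ⟩ := G.toQuasimetric.minimalModel_isDeformationRetract 0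
    refine (Set.eq_univ_of_forall fun x => ?_).symm
    have := congrFun (congrArg Subtype.val hρ.eq_of_zero) x
    exact (show (ρ.1 x).1 = x from this) ▸ (ρ.1 x).2

theorem idempotentJump_isFiltered (k : WithTop (Fin G.jumpSet.card)) :
    FilteredComplex.IsFiltered (A := G.reachabilityComplex K) (B := G.reachabilityComplex K)
      (idempotentJump (G.rcIdem K) G.jumpSet k : End (G.reachabilityComplex K).C) := by
  induction k using WithTop.recTopCoe with
  | top => exact rcMap_isFiltered _
  | coe k => exact (rcMap_isFiltered _).sub (rcMap_isFiltered _)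

/-- The jump at `r_k` is the difference of two idempotents which are `r_k`-homotopic to each other,
so it vanishes on the page `E^{r_k+1}`. -/
theorem idempotentJump_apply_mem_B (k : Fin G.jumpSet.card) {p n : ℤ} {x : G.RCMod K n}
    (hx : x ∈ (G.reachabilityComplex K).Z
      (((G.jumpSet.orderEmbOfFin rfl k + 1 : ℕ) : ℤ) + 1) p n) :
    ((idempotentJump (G.rcIdem K) G.jumpSet k : End (G.reachabilityComplex K).C).f n).hom x ∈
      (G.reachabilityComplex K).B (((G.jumpSet.orderEmbOfFin rfl k + 1 : ℕ) : ℤ) + 1) p n := by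
  set i := G.jumpSet.orderEmbOfFin rfl k
  have h : Homotopic ((i + 1 : ℕ) : ℝ≥0) (G.toQuasimetric.minIdem (i + 1)).1
      (G.toQuasimetric.minIdem i).1 := (G.toQuasimetric.minIdem_succ i).2.2.1
  exact sub_mem_B_of_homotopic h hx

end Digraph

open Quasimetric FilteredComplex Digraph in
theorem theorem3p3 (K : Type v) [CommRing K] {V : Type u} [Finite V] (G : Digraph V) :
    ∃ (n : ℕ) (r : Fin n → ℕ),
      StrictMono r ∧
      G.toQuasimetric.jumpingPoints = Set.range (fun k => (r k : ℝ≥0)) ∧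
      ∃ S : WithTop (Fin n) → HomologicalSpectralSequence.{v, max u v} K,
        (∃ f : ∀ k, S k ⟶ G.magnitudePathSS K,
          IsDirectSumOfSpectralSequences S (G.magnitudePathSS K) f) ∧
        (∀ (k : Fin n) (pq : ℤ × ℤ), Subsingleton (((S k).page ((r k : ℤ) + 1)).X pq)) ∧
        (∀ (j : Fin n) {W : Type u} (H : Digraph W),
          H.toQuasimetric.IsMinimalModel (r j) G.toQuasimetric →
          ∃ f : ∀ k : {k : WithTop (Fin n) // (j : WithTop (Fin n)) < k},
              S k.1 ⟶ H.magnitudePathSS K,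
            IsDirectSumOfSpectralSequences
              (fun k : {k : WithTop (Fin n) // (j : WithTop (Fin n)) < k} => S k.1)
              (H.magnitudePathSS K) f) ∧
        Nonempty (G.stableModel.magnitudePathSS K ≅ S ⊤) := by
  classical
  let Q := idempotentJump (G.rcIdem K) G.jumpSet
  have hP := G.rcIdem_mul K
  have hJ : ∀ i ∉ G.jumpSet, G.rcIdem K (i + 1) = G.rcIdem K i := fun i => G.rcIdem_succ K
  choose S i π hi hπ hiπ hπi using fun k => exists_split (Q k)
    (G.idempotentJump_isFiltered K k) (idempotentJump_mul_self hP k)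
  have hiQ : ∀ k, i k ≫ Q k = i k := fun k => by
    rw [← hπi, ← Category.assoc, hiπ, Category.id_comp]
  have hQπ : ∀ k, Q k ≫ π k = π k := fun k => by
    rw [← hπi, Category.assoc, hiπ, Category.comp_id]
  have horth : ∀ k l, k ≠ l → i k ≫ π l = 0 := by
    intro k l hkl
    have h0 : Q k ≫ Q l = 0 := by
      rcases lt_or_gt_of_ne hkl with h | h
      · exact (idempotentJump_mul_of_lt hP h).2
      · exact (idempotentJump_mul_of_lt hP h).1
    rw [← hiQ k, ← hQπ l, Category.assoc, ← Category.assoc (Q k), h0]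
    simp
  -- `S k` lies in the image of the idempotent with index `N` when the `k`-th jump is beyond `N`.
  have hfix : ∀ {N : ℕ}, N ≤ G.jumpSet.sup Nat.succ → ∀ k : WithTop (Fin G.jumpSet.card),
      (∀ l : Fin G.jumpSet.card, k = l → N ≤ G.jumpSet.orderEmbOfFin rfl l) →
      i k ≫ G.rcIdem K N = i k := by
    intro N hN k hk
    have h : Q k ≫ G.rcIdem K N = Q k := mul_idempotentJump hP hN k hk
    rw [← hiQ k, Category.assoc, h]
  refine ⟨G.jumpSet.card, fun k => G.jumpSet.orderEmbOfFin rfl k + 1,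
    fun k l h => Nat.succ_lt_succ ((G.jumpSet.orderEmbOfFin rfl).lt_iff_lt.2 h),
    G.jumpingPoints_eq, fun k => (S k).spectralSequence,
    ⟨fun k => spectralMap (i k) (hi k), ?_⟩, ?_, ?_, ?_⟩
  · refine isDirectSum_spectralMap S i hi π hπ hiπ horth ?_
    simp only [hπi]
    have := sum_idempotentJump hJ (Nat.zero_le _) (fun _ => True) trivial (fun _ => by simp)
    rw [Finset.filter_true, rcIdem_zero] at this
    exact this
  · intro k pq
    refine ⟨fun e e' => ?_⟩
    suffices h : ∀ e : (S k).E _ pq, e = 0 from (h e).trans (h e').symm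
    intro e
    obtain ⟨x, hx, rfl⟩ := (S k).cls_surj e
    rw [cls_eq_zero]
    have h := (hπ k).map_B (G.idempotentJump_apply_mem_B K k ((hi k).map_Z hx))
    have h' : i k ≫ Q k ≫ π k = 𝟙 _ := by rw [hQπ, hiπ]
    have h'' := congrArg (fun f : (S k).C ⟶ (S k).C => (f.f (pq.1 + pq.2)).hom x) h'
    exact (show _ = x from h'') ▸ h
  · intro j W H hH
    -- `RC(H)` is identified with the image of the idempotent with index `r j`, which is the sum of
    -- the jumps beyond `j`.
    obtain ⟨α, β, h1, h2⟩ := G.exists_splitting hH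
    rw [Nat.floor_natCast] at h2
    have h1' : rcMap K β ≫ rcMap K α = 𝟙 _ := by rw [← rcMap_comp, h1]; exact rcMap_id
    have h2' : rcMap K α ≫ rcMap K β = G.rcIdem K (G.jumpSet.orderEmbOfFin rfl j + 1) := by
      rw [← rcMap_comp, h2]; rfl
    have hlt : ∀ l : Fin G.jumpSet.card, (j : WithTop (Fin G.jumpSet.card)) < l ↔
        G.jumpSet.orderEmbOfFin rfl j + 1 ≤ G.jumpSet.orderEmbOfFin rfl l := fun l => by
      rw [WithTop.coe_lt_coe, ← (G.jumpSet.orderEmbOfFin rfl).lt_iff_lt, Nat.succ_le_iff]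
    have hii : ∀ k l : {k : WithTop (Fin G.jumpSet.card) // (j : WithTop _) < k},
        (i k.1 ≫ rcMap K α) ≫ rcMap K β ≫ π l.1 = i k.1 ≫ π l.1 := by
      intro k l
      rw [Category.assoc, ← Category.assoc (rcMap K α), h2', ← Category.assoc,
        hfix (orderEmbOfFin_succ_le_sup j) k.1 fun l hl => (hlt l).1 (hl ▸ k.2)]
    refine ⟨_, isDirectSum_spectralMap (fun k : {k // (j : WithTop _) < k} => S k.1)
      (A := H.reachabilityComplex K) (fun k => i k.1 ≫ rcMap K α)
      (fun k => (hi k.1).comp (rcMap_isFiltered α)) (fun k => rcMap K β ≫ π k.1)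
      (fun k => (rcMap_isFiltered β).comp (hπ k.1)) (fun k => (hii k k).trans (hiπ k.1))
      (fun k l hkl => (hii k l).trans (horth _ _ fun h => hkl (Subtype.ext h))) ?_⟩
    have hsum := sum_idempotentJump hJ (orderEmbOfFin_succ_le_sup j)
      (fun k => (j : WithTop (Fin G.jumpSet.card)) < k) (WithTop.coe_lt_top j) hlt
    have h3 : ∀ k, (rcMap K β ≫ π k) ≫ i k ≫ rcMap K α = rcMap K β ≫ Q k ≫ rcMap K α := by
      intro k
      rw [← hπi]
      simp only [Category.assoc]
    simp only [h3]
    rw [← Preadditive.comp_sum, ← Preadditive.sum_comp,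
      ← Finset.sum_subtype (f := fun k => Q k) (p := fun k => (j : WithTop _) < k)
        (Finset.univ.filter fun k => (j : WithTop _) < k) (by simp), hsum, ← h2',
      Category.assoc, h1', Category.comp_id, h1']
  · obtain ⟨α, β, h1, h2⟩ := G.exists_splitting_stableModel
    have h1' : rcMap K β ≫ rcMap K α = 𝟙 _ := by rw [← rcMap_comp, h1]; exact rcMap_id
    have h2' : rcMap K α ≫ rcMap K β = Q ⊤ := by rw [← rcMap_comp, h2]; rfl
    refine ⟨spectralIso (rcMap K β ≫ π ⊤) ((rcMap_isFiltered β).comp (hπ ⊤))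
      (i ⊤ ≫ rcMap K α) ((hi ⊤).comp (rcMap_isFiltered α)) ?_ ?_⟩
    · rw [Category.assoc, ← Category.assoc (π ⊤), hπi, ← h2', Category.assoc, h1',
        Category.comp_id, h1']
    · rw [Category.assoc, ← Category.assoc (rcMap K α), h2', hQπ, hiπ]
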